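/- **Setting.** Let $S$ (states), $A_1\neq\emptyset$ (control actions) and $\Sigma$ (sensors) be finite, $\Gamma_1,\Gamma_2\subseteq 2^\Sigma$ the query actions of P1 and the attack actions of P2, $\mathbf P:S\times A_1\to\mathcal D(S)$ the transition function, $\mathsf{Obs}(s,\gamma_1,\gamma_2)\subseteq S$ the observation of P1, with $s\in\mathsf{Obs}(s,\gamma_1,\gamma_2)$, and $F\subseteq S$ the goal set of P1. Let $\sigma_0\in\Sigma$ be a sensor hidden from P2, $\tau_r\in\mathbb N$ the delay in P2's reaction and $\epsilon\in(0,1)$. Put $\Gamma_i^2=\{\gamma\in\Gamma_i:\sigma_0\notin\gamma\}$ and assume $\Gamma_1^2,\Gamma_2^2\ne\emptyset$. Write $\mathsf{Post}(B,a)=\{s':\exists s\in B,\ \mathbf P(s,a,s')>0\}$. **Sensor-revealing game $\mathcal H$.** Its states are P1 states $(s,B,\kappa)$ with $s\in B\subseteq S$, nature states $(s,B,a,\gamma_1,\kappa)$ with $\mathsf{Post}(\{s\},a)\subseteq B$, P2 states $(s,B,\gamma_1,\kappa)$ with $s\in B$ (where $a\in A_1$, $\gamma_1\in\Gamma_1$,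 $\kappa\in\{-1,0,\dots,\tau_r\}$), and a sink $q_F$. - At $(s,B,\kappa)$, P1 chooses $(a,\gamma_1)\in A_1\times\Gamma_1$ and the game moves to $(s,\mathsf{Post}(B,a),a,\gamma_1,\kappa')$, where $\kappa'=-1$ if $\kappa=-1$ and $\sigma_0\notin\gamma_1$, and $\kappa'=\min(\kappa+1,\tau_r)$ otherwise. - At $(s,B,a,\gamma_1,\kappa)$ the game moves to $q_F$ if $\mathsf{Post}(\{s\},a)\subseteq F$. If $\mathsf{Post}(\{s\},a)\cap F=\emptyset$, it moves to $(s',B,\gamma_1,\kappa)$ with probability $\mathbf P(s,a,s')$. Otherwise it moves to $q_F$ with probability $\epsilon$ and to $(s',B,\gamma_1,\kappa)$ with probability $(1-\epsilon)\mathbf P(s,a,s')$. - At $(s,B,\gamma_1,\kappa)$, P2 chooses $\gamma_2\in\Gamma_2^2$ if $\kappa<\tau_r$, and $\gamma_2\in\Gamma_2$ if $\kappa=\tau_r$, and the game moves to $(s,B\cap\mathsf{Obs}(s,\gamma_1,\gamma_2),\kappa)$. **Winning regions.** In this game and in each game below, P1 wants to reach $q_F$, and a strategy is a map from prefixes of plays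 to distributions over available moves. A strategy of P1 is belief-based if its choice at $(s,B,\kappa)$ depends on $(B,\kappa)$ only. Given a belief-based $\pi_1$, a state $q$ and a class of opponent strategies, the *positions P1 has to reckon with* are the least set that contains $q$, contains with each of its states every state reached from it with positive probability under $\pi_1$ and some opponent strategy of the class, and contains with each P1 state $(s,B,\kappa)$ all $(t,B,\kappa)$, $t\in B$. P1 *wins from $q$ against the class* if some belief-based $\pi_1$ uses only available moves at all these positions and reaches $q_F$ with probability one from each of them against every strategy of the class. For a game $\mathcal G$: - $\mathsf{ASW}_1(\mathcal G)$ is the set of states from which P1 wins against all strategies of P2. - $\mathsf{ASW}_2(\mathcal G)$ (resp. $\mathsf{PWin}_2(\mathcal G)$) is the set of states from which P2 has a strategy such that against every strategy of P1 the probability of reaching $q_F$ is $0$ (resp. less than $1$). - $\mathsf{PWin}_1(\mathcal G)$ is the set of states from which P1 has a belief-based strategy that reaches $q_F$ with positive probability against every strategy of P2. - For $i\neq j$, $\mathsf{SR}_i(q,\mathcal G)$ is the set of available moves $m$ of player $i$ at $q$ all of whose possible successors lie in $\mathsf{ASW}_i(\mathcal G)$, if $q\in\mathsf{ASW}_i(\mathcal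 G)$. Otherwise, if $q\in\mathsf{PWin}_i(\mathcal G)$, it is the set of those whose possible successors do not all lie in $\mathsf{ASW}_j(\mathcal G)$. In the remaining case it is the set of all available moves. **Derived games.** - $\mathcal G^+$ is the restriction of $\mathcal H$ to $Q^+\cup\{q_F\}$, where $Q^+$ is the set of states with $\kappa\ge0$. - $\mathcal G^2$ is the restriction of $\mathcal H$ to $q_F$ and the states with $\kappa=-1$ (only those nature states with $\sigma_0\notin\gamma_1$), in which P1 uses only $A_1\times\Gamma_1^2$ and P2 only $\Gamma_2^2$. - $\mathcal G^0$ has as states $q_F$, the P1 and P2 states with $\kappa=-1$, and the nature states with $\kappa\in\{-1,0\}$. A state of $\mathsf{ASW}_1(\mathcal G^2)$ moves to $q_F$ under every move available in $\mathcal H$. A state of $\mathsf{ASW}_2(\mathcal G^2)$ is a sink. A nature state with $\kappa=0$ moves to $q_F$ if it lies in $\mathsf{ASW}_1(\mathcal G^+)$, and is a sink otherwise. All other transitions are those of $\mathcal H$. At a P1 state $q\notin\mathsf{ASW}_1(\mathcal G^2)\cup\mathsf{ASW}_2(\mathcal G^2)$, P1 can use $\mathsf{SR}_1(q,\mathcal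 G^2)$ and all $(a,\gamma_1)$ with $\sigma_0\in\gamma_1\in\Gamma_1$. At a P2 state outside these two regions, P2 can use $\mathsf{SR}_2(q,\mathcal G^2)$. A strategy of P2 in $\mathcal H$ is *behaviorally subjectively rationalizable* if it depends on the current state $q$ only and its support at each P2 state $q$ is contained in $\mathsf{SR}_2(q,\mathcal G^2)$ if $\kappa=-1$, and in $\mathsf{SR}_2(q,\mathcal G^+)$ if $\kappa\ge0$. $\mathsf{DASW}_1(\mathcal H)$ is the set of states of $\mathcal H$ from which P1 wins against the class of these strategies. **Lemma.** $\mathsf{DASW}_1(\mathcal H)\supseteq\mathsf{ASW}_1(\mathcal G^0)\cup\mathsf{ASW}_1(\mathcal G^+)$, and $\mathsf{DASW}_1(\mathcal H)\cap Q^+=\mathsf{ASW}_1(\mathcal G^+)\cap Q^+$. -/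

import Mathlib

namespace SensorDeception

open scoped NNReal ENNReal

noncomputable section

open scoped Classical

/-- A two-player stochastic reachability game with active sensing and sensor attacks, together with
the sensor `hidden` of P1 that P2 does not know initially. States, control actions and sensors are
the types `S`, `A`, `Sen`. The true state is always consistent with the observation P1 receives
(`mem_obs`). Each player owns at least one action that does not involve the hidden sensor, so that
the game P2 initially believes to be played can be played. -/
structure SensorGame (S A Sen : Type*) where
  /-- P1's sensor query actions -/
  query : Set (Set Sen)
  /-- P2's sensor attack actions -/
  attack : Set (Set Sen)
  /-- probabilistic transition function -/
  P : S → A → PMF S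
  /-- the set of all observations -/
  O : Set (Set S)
  /-- `obs s γ₁ γ₂` is what P1 observes in `s` under query `γ₁` and attack `γ₂` -/
  obs : S → Set Sen → Set Sen → Set S
  obs_mem : ∀ s, ∀ γ₁ ∈ query, ∀ γ₂ ∈ attack, obs s γ₁ γ₂ ∈ O
  mem_obs : ∀ s, ∀ γ₁ ∈ query, ∀ γ₂ ∈ attack, s ∈ obs s γ₁ γ₂
  /-- initial state -/
  s₀ : S
  /-- initial observation -/
  o₀ : Set S
  o₀_mem : o₀ ∈ O
  s₀_mem : s₀ ∈ o₀
  /-- P1's goal states -/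
  F : Set S
  /-- the sensor hidden from P2 -/
  hidden : Sen
  exists_action : Nonempty A
  exists_query : ∃ γ ∈ query, hidden ∉ γ
  exists_attack : ∃ γ ∈ attack, hidden ∉ γ

/-- The values `-1, 0, …, τ` of the counter `κ`: `-1` as long as the hidden sensor has not been
queried, afterwards the number of rounds elapsed, capped at P2's delay in reaction `τ`. -/
abbrev Counter (τ : ℕ) : Type := Set.Icc (-1 : ℤ) (τ : ℤ)

/-- Game positions: P1's states `(s, B, κ)`, nature's states `(s, B, a, γ₁, κ)`, P2's states
`(s, B, γ₁, κ)`, and the fictitious final state `q_F`. -/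
inductive Vertex (S A Sen : Type*) (τ : ℕ)
  | p1 (s : S) (B : Set S) (κ : Counter τ)
  | nature (s : S) (B : Set S) (a : A) (γ : Set Sen) (κ : Counter τ)
  | p2 (s : S) (B : Set S) (γ : Set Sen) (κ : Counter τ)
  | final

/-- Moves: P1's control and sensing actions, P2's attacks, and the dummy move of nature. -/
inductive Move (A Sen : Type*)
  | control (a : A) (γ : Set Sen)
  | attack (γ : Set Sen)
  | chance

variable {S A Sen : Type*} {τ : ℕ}

/-- It is P1's turn. -/
def Vertex.IsP1 : Vertex S A Sen τ → Prop
  | .p1 _ _ _ => True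
  | _ => False

/-- It is P2's turn. -/
def Vertex.IsP2 : Vertex S A Sen τ → Prop
  | .p2 _ _ _ _ => True
  | _ => False

/-! ### Stochastic games on these positions, strategies and winning regions -/

/-- A turn-based stochastic game: positions, available moves, transition probabilities. The
objective of P1 is to reach `Vertex.final`, which is a sink in every game below. -/
structure Arena (S A Sen : Type*) (τ : ℕ) where
  verts : Set (Vertex S A Sen τ)
  avail : Vertex S A Sen τ → Set (Move A Sen)
  δ : Vertex S A Sen τ → Move A Sen → PMF (Vertex S A Sen τ)

/-- The past of a play: the positions visited before the current one, each with the move made. -/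
abbrev History (S A Sen : Type*) (τ : ℕ) := List (Vertex S A Sen τ × Move A Sen)

/-- A randomized strategy (of either player): a distribution over moves that depends on the prefix
of the play, i.e. on the past and on the current position. -/
abbrev Strategy (S A Sen : Type*) (τ : ℕ) :=
  History S A Sen τ → Vertex S A Sen τ → PMF (Move A Sen)

/-- `π` does not depend on the true state: at `(s, B, κ)` it depends on `B` and `κ` only. -/
def BeliefBased (π : Strategy S A Sen τ) : Prop :=
  ∃ f : Set S → Counter τ → PMF (Move A Sen), ∀ h s B κ, π h (.p1 s B κ) = f B κ

namespace Arena

variable (G : Arena S A Sen τ)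

/-- The states that can be reached from `q` in one step by the move `m`. -/
def post (q : Vertex S A Sen τ) (m : Move A Sen) : Set (Vertex S A Sen τ) := (G.δ q m).support

/-- All strategies of P1 in `G`. -/
def strategies1 : Set (Strategy S A Sen τ) :=
  {π | ∀ h, ∀ v ∈ G.verts, v.IsP1 → (π h v).support ⊆ G.avail v}

/-- All strategies of P2 in `G`. -/
def strategies2 : Set (Strategy S A Sen τ) :=
  {π | ∀ h, ∀ v ∈ G.verts, v.IsP2 → (π h v).support ⊆ G.avail v}

/-- The law of the move that is made next. -/
def nextMove (π₁ π₂ : Strategy S A Sen τ) (h : History S A Sen τ) :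
    Vertex S A Sen τ → PMF (Move A Sen)
  | .p1 s B κ => π₁ h (.p1 s B κ)
  | .p2 s B γ κ => π₂ h (.p2 s B γ κ)
  | .nature _ _ _ _ _ => PMF.pure .chance
  | .final => PMF.pure .chance

/-- The law of the first `n` steps of the play from `q` under `(π₁, π₂)`. -/
def playDist (π₁ π₂ : Strategy S A Sen τ) (q : Vertex S A Sen τ) :
    ℕ → PMF (History S A Sen τ × Vertex S A Sen τ)
  | 0 => PMF.pure ([], q)
  | n + 1 => (playDist π₁ π₂ q n).bind fun x =>
      (nextMove π₁ π₂ x.1 x.2).bind fun m => (G.δ x.2 m).map fun v => (x.1 ++ [(x.2, m)], v)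

/-- The law of the position after `n` steps. -/
def stateDist (π₁ π₂ : Strategy S A Sen τ) (q : Vertex S A Sen τ) (n : ℕ) :
    PMF (Vertex S A Sen τ) :=
  (G.playDist π₁ π₂ q n).map Prod.snd

/-- The probability that the play from `q` reaches the final state. As that state is a sink, the
probability of being there after `n` steps is that of having reached it within `n` steps; it
increases with `n` to the probability of ever reaching it. -/
def reachProb (π₁ π₂ : Strategy S A Sen τ) (q : Vertex S A Sen τ) : ℝ≥0∞ :=
  ⨆ n, G.stateDist π₁ π₂ q n .final

/-- The positions that P1, who plays `π₁` from `q` against opponents in `Opp` and knows only its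
belief, has to reckon with: those that can arise in a play, and at any P1 state `(s, B, κ)` among
them also every `(t, B, κ)` with `t ∈ B`. -/
inductive Possible (Opp : Set (Strategy S A Sen τ)) (π₁ : Strategy S A Sen τ)
    (q : Vertex S A Sen τ) : Vertex S A Sen τ → Prop
  | start : Possible Opp π₁ q q
  | play {v w : Vertex S A Sen τ} {π₂ : Strategy S A Sen τ} {n : ℕ} :
      Possible Opp π₁ q v → π₂ ∈ Opp → w ∈ (G.stateDist π₁ π₂ v n).support →
        Possible Opp π₁ q w
  | belief {s t : S} {B : Set S} {κ : Counter τ} :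
      Possible Opp π₁ q (.p1 s B κ) → t ∈ B → Possible Opp π₁ q (.p1 t B κ)

/-- The states from which P1 has a belief-based strategy that reaches the final state with
probability one against every opponent strategy in `Opp`, whichever of the positions that P1 has to
reckon with is the true one. Only available moves may be used at these positions. -/
def winRegion (Opp : Set (Strategy S A Sen τ)) : Set (Vertex S A Sen τ) :=
  {q | q ∈ G.verts ∧ ∃ π₁, BeliefBased π₁ ∧ ∀ v, G.Possible Opp π₁ q v →
    (v.IsP1 → (π₁ [] v).support ⊆ G.avail v) ∧ ∀ π₂ ∈ Opp, G.reachProb π₁ π₂ v = 1}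

/-- P1's (belief-based) almost-sure winning region. -/
def ASW1 : Set (Vertex S A Sen τ) := G.winRegion G.strategies2

/-- P2's almost-sure winning region. -/
def ASW2 : Set (Vertex S A Sen τ) :=
  {q | q ∈ G.verts ∧ ∃ π₂ ∈ G.strategies2, ∀ π₁ ∈ G.strategies1, G.reachProb π₁ π₂ q = 0}

/-- P1's positive winning region. -/
def PWin1 : Set (Vertex S A Sen τ) :=
  {q | q ∈ G.verts ∧ ∃ π₁ ∈ G.strategies1, BeliefBased π₁ ∧
    ∀ π₂ ∈ G.strategies2, 0 < G.reachProb π₁ π₂ q}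

/-- P2's positive winning region. -/
def PWin2 : Set (Vertex S A Sen τ) :=
  {q | q ∈ G.verts ∧ ∃ π₂ ∈ G.strategies2, ∀ π₁ ∈ G.strategies1, G.reachProb π₁ π₂ q < 1}

/-- P1's subjectively rationalizable moves. -/
def SR1 (q : Vertex S A Sen τ) : Set (Move A Sen) :=
  if q ∈ G.ASW1 then {m ∈ G.avail q | G.post q m ⊆ G.ASW1}
  else if q ∈ G.PWin1 then {m ∈ G.avail q | ¬ G.post q m ⊆ G.ASW2}
  else G.avail q

/-- P2's subjectively rationalizable moves. -/
def SR2 (q : Vertex S A Sen τ) : Set (Move A Sen) :=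
  if q ∈ G.ASW2 then {m ∈ G.avail q | G.post q m ⊆ G.ASW2}
  else if q ∈ G.PWin2 then {m ∈ G.avail q | ¬ G.post q m ⊆ G.ASW1}
  else G.avail q

end Arena

/-! ### The sensor-revealing game -/

/-- `mix ε p r` is the distribution `ε • p + (1 - ε) • r`. -/
def mix {α : Type*} (ε : ℝ≥0) (hε : ε ≤ 1) (p r : PMF α) : PMF α :=
  (PMF.ofFintype (fun b : Bool => cond b (ε : ℝ≥0∞) (1 - ε))
    (by simpa using add_tsub_cancel_of_le (by exact_mod_cast hε : (ε : ℝ≥0∞) ≤ 1))).bind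
    fun b => cond b p r

theorem mix_apply {α : Type*} (ε : ℝ≥0) (hε : ε ≤ 1) (p r : PMF α) (x : α) :
    mix ε hε p r x = ε * p x + (1 - ε) * r x := by
  simp [mix, PMF.bind_apply, tsum_fintype]

namespace SensorGame

variable (G : SensorGame S A Sen)

/-- The states that can be reached from `B` by the action `a`. -/
def post (B : Set S) (a : A) : Set S := {s' | ∃ s ∈ B, G.P s a s' ≠ 0}

/-- The counter stays at `-1` until the hidden sensor is queried, then increases by one with each
action of P1 up to `τ`. -/
def nextCounter (γ : Set Sen) (κ : Counter τ) : Counter τ :=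
  if (κ : ℤ) = -1 ∧ G.hidden ∉ γ then κ
  else if h : (κ : ℤ) < τ then ⟨κ + 1, by have := κ.2.1; constructor <;> omega⟩
  else κ

/-- The states of the sensor-revealing game: queries are P1's, and the beliefs are correct, that is,
they contain the true state (at a state of nature: every possible next state). -/
def IsState : Vertex S A Sen τ → Prop
  | .p1 s B _ => s ∈ B
  | .nature s B a γ _ => γ ∈ G.query ∧ G.post {s} a ⊆ B
  | .p2 s B γ _ => γ ∈ G.query ∧ s ∈ B
  | .final => True

/-- Moves available in the sensor-revealing game: P2 can attack the hidden sensor only once the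
counter has reached `τ`. -/
def moves : Vertex S A Sen τ → Set (Move A Sen)
  | .p1 _ _ _ => {m | ∃ a, ∃ γ ∈ G.query, m = .control a γ}
  | .nature _ _ _ _ _ => {.chance}
  | .p2 _ _ _ κ => {m | ∃ γ ∈ G.attack, ((κ : ℤ) < τ → G.hidden ∉ γ) ∧ m = .attack γ}
  | .final => {.chance}

variable (ε : ℝ≥0) (hε : ε ≤ 1)

/-- Transitions of the sensor-revealing game; the last line covers the final state, a sink, and
unavailable moves. -/
def trans : Vertex S A Sen τ → Move A Sen → PMF (Vertex S A Sen τ)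
  | .p1 s B κ, .control a γ => PMF.pure (.nature s (G.post B a) a γ (G.nextCounter γ κ))
  | .nature s B a γ κ, .chance =>
      if G.post {s} a ⊆ G.F then PMF.pure .final
      else if G.post {s} a ∩ G.F = ∅ then (G.P s a).map fun s' => .p2 s' B γ κ
      else mix ε hε (PMF.pure .final) ((G.P s a).map fun s' => .p2 s' B γ κ)
  | .p2 s B γ κ, .attack γ₂ => PMF.pure (.p1 s (B ∩ G.obs s γ γ₂) κ)
  | v, _ => PMF.pure v

/-- The sensor-revealing game `H` with delay in reaction `τ`. -/
def revealingGame (τ : ℕ) : Arena S A Sen τ where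
  verts := {v | G.IsState v}
  avail := G.moves
  δ := G.trans ε hε

/-- `Q⁺`: the states other than the final one in which the hidden sensor has been revealed. -/
def revealedStates (τ : ℕ) : Set (Vertex S A Sen τ) :=
  {v | G.IsState v ∧ match v with
    | .p1 _ _ κ => 0 ≤ (κ : ℤ)
    | .nature _ _ _ _ κ => 0 ≤ (κ : ℤ)
    | .p2 _ _ _ κ => 0 ≤ (κ : ℤ)
    | .final => False}

/-- The delay-attack game `G⁺`. -/
def delayAttackGame (τ : ℕ) : Arena S A Sen τ where
  verts := G.revealedStates τ ∪ {.final}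
  avail := G.moves
  δ := G.trans ε hε

/-- The belief-augmented perceptual game `G²` of P2: the hidden sensor is neither queried nor
attacked. -/
def perceptualGame (τ : ℕ) : Arena S A Sen τ where
  verts := {v | G.IsState v ∧ match v with
    | .p1 _ _ κ => (κ : ℤ) = -1
    | .nature _ _ _ γ κ => (κ : ℤ) = -1 ∧ G.hidden ∉ γ
    | .p2 _ _ _ κ => (κ : ℤ) = -1
    | .final => True}
  avail
    | .p1 _ _ _ => {m | ∃ a, ∃ γ ∈ G.query, G.hidden ∉ γ ∧ m = .control a γ}
    | .nature _ _ _ _ _ => {.chance}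
    | .p2 _ _ _ _ => {m | ∃ γ ∈ G.attack, G.hidden ∉ γ ∧ m = .attack γ}
    | .final => {.chance}
  δ := G.trans ε hε

/-- The initial game `G⁰`. States that P1 wins almost surely in `G²` lead to the final state, those
that P2 wins almost surely in `G²` are sinks. At the other states the players use their
subjectively rationalizable moves of `G²`, and P1 may also query the hidden sensor, which leads to
a state of nature with counter `0`; it leads to the final state if P1 wins it almost surely in `G⁺`
and is a sink otherwise. -/
def initialGame (τ : ℕ) : Arena S A Sen τ where
  verts := {v | G.IsState v ∧ match v with
    | .p1 _ _ κ => (κ : ℤ) = -1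
    | .nature _ _ _ _ κ => (κ : ℤ) = -1 ∨ (κ : ℤ) = 0
    | .p2 _ _ _ κ => (κ : ℤ) = -1
    | .final => True}
  avail v :=
    if v ∈ (G.perceptualGame ε hε τ).ASW1 ∪ (G.perceptualGame ε hε τ).ASW2 then G.moves v
    else match v with
      | .p1 s B κ => (G.perceptualGame ε hε τ).SR1 (.p1 s B κ) ∪
          {m | ∃ a, ∃ γ ∈ G.query, G.hidden ∈ γ ∧ m = .control a γ}
      | .nature _ _ _ _ _ => {.chance}
      | .p2 s B γ κ => (G.perceptualGame ε hε τ).SR2 (.p2 s B γ κ)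
      | .final => {.chance}
  δ v m :=
    if v ∈ (G.perceptualGame ε hε τ).ASW1 then PMF.pure .final
    else if v ∈ (G.perceptualGame ε hε τ).ASW2 then PMF.pure v
    else match v with
      | .nature s B a γ κ =>
          if (κ : ℤ) = 0 then
            if .nature s B a γ κ ∈ (G.delayAttackGame ε hε τ).ASW1 then PMF.pure .final
            else PMF.pure (.nature s B a γ κ)
          else G.trans ε hε (.nature s B a γ κ) m
      | v => G.trans ε hε v m

/-- P2's behaviorally subjectively rationalizable strategies in `H`: they depend on the current
state only, and use the moves of P2 that are subjectively rationalizable in `G²` before, and in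
`G⁺` after the hidden sensor has been revealed. -/
def rationalStrategies (τ : ℕ) : Set (Strategy S A Sen τ) :=
  {π | ∃ p : Vertex S A Sen τ → PMF (Move A Sen), (∀ h v, π h v = p v) ∧
    ∀ s B γ (κ : Counter τ), .p2 s B γ κ ∈ (G.revealingGame ε hε τ).verts →
      (p (.p2 s B γ κ)).support ⊆
        if (κ : ℤ) = -1 then (G.perceptualGame ε hε τ).SR2 (.p2 s B γ κ)
        else (G.delayAttackGame ε hε τ).SR2 (.p2 s B γ κ)}

/-- P1's deceptive almost-sure winning region in the sensor-revealing game. -/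
def DASW1 (τ : ℕ) : Set (Vertex S A Sen τ) :=
  (G.revealingGame ε hε τ).winRegion (G.rationalStrategies ε hε τ)

end SensorGame

end

end SensorDeception

namespace SensorDeception

open scoped NNReal ENNReal Classical

variable {S A Sen : Type*} {τ : ℕ}

/-! All arguments about strategies and probabilities are reduced to a combinatorial object, a
`Certificate`: a set `W` of positions, memoryless choices `f` outside P2's positions, and a rank,
such that `W` is closed under `f` and under a prescribed set `R` of P2's moves, and every step can
lower the rank until the final state is reached. Certificates whose `f` depends only on belief and
counter on `W` (`Uniform`) are equivalent to almost-sure winning. They suffice because, in a finite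
game, the rank falls with probability bounded below (`reachProb_eq_one_of_rank`,
`Certificate.subset_winRegion`). They are necessary because the positions P1 has to reckon with form
such a `W`: outside the positive attractor of the final state, P2 could trap the play for ever
(`exists_certificate_of_mem_winRegion`).

Certificates can be glued (`Certificate.extend`): play the first one once its set is entered, the
second one before. This gives the first inclusion. In the revealing game P2's rational moves are
among those of `G⁺` and `G²`, so the certificates of both games carry over. A winning position of
`G⁰` outside the two regions has the same transitions and the same P2 moves as in the revealing
game, and wherever `G⁰` redirects a winning play to the final state, one of these two certificates
takes over.

For the converse on `Q⁺`, restrict a certificate against rational moves to `G⁺`, where P2 uses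
`SR2`. The point is `Certificate.of_SR2`: there `SR2` already contains all of P2's moves. The set
`W` misses P2's almost-sure region, so any move that rationality excludes leads into P1's
almost-sure region. Hence P1 wins from `W` against all moves, `W` misses P2's positive region too,
and on `W` rationality excludes nothing. -/

/-! ### Finiteness of positions and moves. -/

instance instFiniteVertex [Finite S] [Finite A] [Finite Sen] : Finite (Vertex S A Sen τ) := by
  refine Finite.of_surjective
    (α := (S × Set S × Counter τ) ⊕ (S × Set S × A × Set Sen × Counter τ) ⊕
      (S × Set S × Set Sen × Counter τ) ⊕ Unit)
    (Sum.elim (fun x => .p1 x.1 x.2.1 x.2.2)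
      (Sum.elim (fun x => .nature x.1 x.2.1 x.2.2.1 x.2.2.2.1 x.2.2.2.2)
        (Sum.elim (fun x => .p2 x.1 x.2.1 x.2.2.1 x.2.2.2) fun _ => .final))) ?_
  rintro (⟨s, B, κ⟩ | ⟨s, B, a, γ, κ⟩ | ⟨s, B, γ, κ⟩ | _)
  · exact ⟨.inl (s, B, κ), rfl⟩
  · exact ⟨.inr (.inl (s, B, a, γ, κ)), rfl⟩
  · exact ⟨.inr (.inr (.inl (s, B, γ, κ))), rfl⟩
  · exact ⟨.inr (.inr (.inr ())), rfl⟩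

instance instFiniteMove [Finite A] [Finite Sen] : Finite (Move A Sen) := by
  refine Finite.of_surjective (α := (A × Set Sen) ⊕ Set Sen ⊕ Unit)
    (Sum.elim (fun x => .control x.1 x.2) (Sum.elim .attack fun _ => .chance)) ?_
  rintro (⟨a, γ⟩ | γ | _)
  · exact ⟨.inl (a, γ), rfl⟩
  · exact ⟨.inr (.inl γ), rfl⟩
  · exact ⟨.inr (.inr ()), rfl⟩

/-! ### Expectations under discrete distributions -/

theorem tsum_bind_mul {α β : Type*} (p : PMF α) (g : α → PMF β) (φ : β → ℝ≥0∞) :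
    ∑' y, (p.bind g) y * φ y = ∑' x, p x * ∑' y, g x y * φ y := by
  simp only [PMF.bind_apply, ← ENNReal.tsum_mul_right, ← ENNReal.tsum_mul_left]
  rw [ENNReal.tsum_comm]
  simp only [mul_assoc]

theorem tsum_pure_mul {α : Type*} (a : α) (φ : α → ℝ≥0∞) :
    ∑' y, (PMF.pure a) y * φ y = φ a := by
  rw [tsum_eq_single a]
  · simp
  · intro b hb
    simp [PMF.pure_apply, hb]

theorem tsum_map_mul {α β : Type*} (p : PMF α) (g : α → β) (φ : β → ℝ≥0∞) :
    ∑' y, (p.map g) y * φ y = ∑' x, p x * φ (g x) := by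
  rw [PMF.map, tsum_bind_mul]
  simp only [Function.comp_apply, tsum_pure_mul]

theorem tsum_mul_le_of_support {α : Type*} (p : PMF α) (φ : α → ℝ≥0∞) (b : ℝ≥0∞)
    (h : ∀ x ∈ p.support, φ x ≤ b) : ∑' x, p x * φ x ≤ b := by
  calc ∑' x, p x * φ x ≤ ∑' x, p x * b := by
        refine ENNReal.tsum_le_tsum fun x => ?_
        by_cases hx : p x = 0
        · simp [hx]
        · gcongr
          exact h x ((p.mem_support_iff x).2 hx)
    _ = b := by rw [ENNReal.tsum_mul_right, p.tsum_coe, one_mul]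

theorem eq_pure_of_support_subset {α : Type*} {p : PMF α} {a : α} (h : p.support ⊆ {a}) :
    p = PMF.pure a := by
  have h1 : p.support = {a} := h.antisymm (by
    obtain ⟨b, hb⟩ := p.support_nonempty
    have := h hb
    simp only [Set.mem_singleton_iff] at this
    simpa [this] using hb)
  have h2 : p a = 1 := (p.apply_eq_one_iff a).2 h1
  ext x
  by_cases hx : x = a
  · simp [hx, h2]
  · rw [PMF.pure_apply, if_neg hx, PMF.apply_eq_zero_iff, h1]
    simpa using hx

/-- Applied to transition probabilities, this makes the chance of progress uniform. The bound `c ≤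
1` leads to `β ≤ 1 / 2` later. -/
theorem exists_pos_le_of_ne_zero {ι : Type*} [Finite ι] (g : ι → ℝ≥0∞) :
    ∃ c : ℝ, 0 < c ∧ c ≤ 1 ∧ ∀ i, g i ≠ 0 → ENNReal.ofReal c ≤ g i := by
  have : ∀ i, ∃ c : ℝ, 0 < c ∧ (g i ≠ 0 → ENNReal.ofReal c ≤ g i) := by
    intro i
    by_cases h0 : g i = 0
    · exact ⟨1, one_pos, fun h => absurd h0 h⟩
    by_cases ht : g i = ⊤
    · exact ⟨1, one_pos, fun _ => by simp [ht]⟩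
    · exact ⟨(g i).toReal, ENNReal.toReal_pos h0 ht, fun _ => by rw [ENNReal.ofReal_toReal ht]⟩
  choose c hc hcg using this
  obtain ⟨b, hb⟩ : ∃ b : ℝ, 0 < b ∧ ∀ i, b ≤ c i := by
    cases isEmpty_or_nonempty ι
    · exact ⟨1, one_pos, fun i => isEmptyElim i⟩
    · obtain ⟨i, hi⟩ := Finite.exists_min c
      exact ⟨c i, hc i, hi⟩
  refine ⟨min b 1, lt_min hb.1 one_pos, min_le_right _ _, fun i hi => ?_⟩
  exact (ENNReal.ofReal_le_ofReal ((min_le_left _ _).trans (hb.2 i))).trans (hcg i hi)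

/-- The potential `1 - β ^ r` contracts under a distribution that gives probability at least
`2 * β` to a point of smaller rank. -/
theorem tsum_potential_le {V : Type*} (r : V → ℕ) {K k : ℕ} {β : ℝ} (hβ : 0 < β) (hβ' : β ≤ 1 / 2)
    (hk : k ≤ K) (μ : PMF V) {w : V} (hw : r w < k) (hc : ENNReal.ofReal (2 * β) ≤ μ w) :
    ∑' u, μ u * ENNReal.ofReal (1 - β ^ r u) ≤
      ENNReal.ofReal (1 - β ^ K) * ENNReal.ofReal (1 - β ^ k) := by
  have h1 : ∀ n : ℕ, 0 < β ^ n := fun n => pow_pos hβ n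
  have h2 : ∀ n : ℕ, β ^ n ≤ 1 := fun n => pow_le_one₀ hβ.le (by linarith)
  have hanti : ∀ {a b : ℕ}, a ≤ b → β ^ b ≤ β ^ a := fun h =>
    pow_le_pow_of_le_one hβ.le (by linarith) h
  -- The point `w` alone contributes `μ w * β ^ r w ≥ 2 * β * β ^ (k - 1) = 2 * β ^ k` to the gap
  -- between the expected potential and `1`.
  have key : ∑' u, μ u * ENNReal.ofReal (1 - β ^ r u) + ENNReal.ofReal (2 * β ^ k) ≤ 1 := by
    calc _ ≤ ∑' u, μ u * ENNReal.ofReal (1 - β ^ r u) + μ w * ENNReal.ofReal (β ^ r w) := by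
          gcongr
          have : ENNReal.ofReal (2 * β ^ k) ≤
              ENNReal.ofReal (2 * β) * ENNReal.ofReal (β ^ r w) := by
            rw [← ENNReal.ofReal_mul (by positivity)]
            refine ENNReal.ofReal_le_ofReal ?_
            have h3 : β ^ k ≤ β ^ (r w + 1) := hanti hw
            rw [pow_succ] at h3
            nlinarith
          exact this.trans (by gcongr)
      _ = ∑' u, μ u * ENNReal.ofReal (1 - β ^ r u) +
            ∑' u, μ u * (if u = w then ENNReal.ofReal (β ^ r u) else 0) := by
          congr 1
          rw [tsum_eq_single w]
          · simp
          · intro u hu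
            simp [hu]
      _ = ∑' u, μ u * (ENNReal.ofReal (1 - β ^ r u) +
            (if u = w then ENNReal.ofReal (β ^ r u) else 0)) := by
          rw [← ENNReal.tsum_add]
          simp only [mul_add]
      _ ≤ 1 := by
          refine tsum_mul_le_of_support μ _ 1 fun u _ => ?_
          split_ifs
          · rw [← ENNReal.ofReal_add (by linarith [h2 (r u)]) (h1 _).le]
            simp
          · rw [add_zero, ← ENNReal.ofReal_one]
            exact ENNReal.ofReal_le_ofReal (by linarith [h1 (r u)])
  have h3 := ENNReal.le_sub_of_add_le_right ENNReal.ofReal_ne_top key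
  refine h3.trans ?_
  rw [← ENNReal.ofReal_one, ← ENNReal.ofReal_sub _ (by positivity),
    ← ENNReal.ofReal_mul (by linarith [h2 K])]
  refine ENNReal.ofReal_le_ofReal ?_
  -- `1 - 2 * β ^ k ≤ (1 - β ^ K) * (1 - β ^ k)` because `β ^ K ≤ β ^ k`: half of the gap pays for
  -- the factor.
  have := hanti hk
  nlinarith [mul_pos (h1 K) (h1 k)]

namespace Arena

variable {G : Arena S A Sen τ} {π₁ π₂ : Strategy S A Sen τ}

/-! ### Plays -/

theorem nextMove_of_isP1 {h : History S A Sen τ} {v : Vertex S A Sen τ} (hv : v.IsP1) :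
    nextMove π₁ π₂ h v = π₁ h v := by
  cases v <;> simp_all [Vertex.IsP1, nextMove]

theorem nextMove_of_isP2 {h : History S A Sen τ} {v : Vertex S A Sen τ} (hv : v.IsP2) :
    nextMove π₁ π₂ h v = π₂ h v := by
  cases v <;> simp_all [Vertex.IsP2, nextMove]

theorem nextMove_of_not {h : History S A Sen τ} {v : Vertex S A Sen τ} (h1 : ¬ v.IsP1)
    (h2 : ¬ v.IsP2) : nextMove π₁ π₂ h v = PMF.pure .chance := by
  cases v <;> simp_all [Vertex.IsP1, Vertex.IsP2, nextMove]

theorem _root_.SensorDeception.Vertex.IsP1.not_isP2 {v : Vertex S A Sen τ} (hv : v.IsP1) :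
    ¬ v.IsP2 := by
  cases v <;> simp_all [Vertex.IsP1, Vertex.IsP2]

theorem mem_support_playDist_succ {q : Vertex S A Sen τ} {n : ℕ}
    {x : History S A Sen τ × Vertex S A Sen τ} :
    x ∈ (G.playDist π₁ π₂ q (n + 1)).support ↔
      ∃ y ∈ (G.playDist π₁ π₂ q n).support, ∃ m ∈ (nextMove π₁ π₂ y.1 y.2).support,
        ∃ w ∈ G.post y.2 m, (y.1 ++ [(y.2, m)], w) = x := by
  simp only [playDist, PMF.mem_support_bind_iff, PMF.mem_support_map_iff, post]

theorem mem_support_stateDist {q w : Vertex S A Sen τ} {n : ℕ} :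
    w ∈ (G.stateDist π₁ π₂ q n).support ↔ ∃ x ∈ (G.playDist π₁ π₂ q n).support, x.2 = w := by
  simp only [stateDist, PMF.mem_support_map_iff]

theorem snd_mem_of_closed {W : Set (Vertex S A Sen τ)}
    (hW : ∀ h, ∀ v ∈ W, ∀ m ∈ (nextMove π₁ π₂ h v).support, G.post v m ⊆ W)
    {q : Vertex S A Sen τ} (hq : q ∈ W) (n : ℕ) :
    ∀ x ∈ (G.playDist π₁ π₂ q n).support, x.2 ∈ W := by
  induction n with
  | zero =>
    intro x hx
    rw [playDist, PMF.support_pure] at hx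
    rw [hx]
    exact hq
  | succ n ih =>
    intro x hx
    obtain ⟨y, hy, m, hm, w, hw, rfl⟩ := mem_support_playDist_succ.1 hx
    exact hW _ _ (ih y hy) m hm hw

theorem reachProb_eq_zero_of_trap {Z : Set (Vertex S A Sen τ)} (hfin : .final ∉ Z)
    (hZ : ∀ h, ∀ v ∈ Z, ∀ m ∈ (nextMove π₁ π₂ h v).support, G.post v m ⊆ Z)
    {q : Vertex S A Sen τ} (hq : q ∈ Z) : G.reachProb π₁ π₂ q = 0 := by
  refine le_antisymm (iSup_le fun n => ?_) bot_le
  rw [nonpos_iff_eq_zero, PMF.apply_eq_zero_iff, mem_support_stateDist]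
  rintro ⟨x, hx, hx'⟩
  exact hfin (hx' ▸ snd_mem_of_closed hZ hq n x hx)

theorem tsum_playDist_succ (q : Vertex S A Sen τ) (n : ℕ) (φ : Vertex S A Sen τ → ℝ≥0∞) :
    ∑' x, G.playDist π₁ π₂ q (n + 1) x * φ x.2 =
      ∑' x, G.playDist π₁ π₂ q n x *
        ∑' m, nextMove π₁ π₂ x.1 x.2 m * ∑' w, G.δ x.2 m w * φ w := by
  rw [playDist, tsum_bind_mul _ _ fun x : History S A Sen τ × Vertex S A Sen τ => φ x.2]
  congr 1
  ext x
  congr 1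
  rw [tsum_bind_mul _ _ fun x : History S A Sen τ × Vertex S A Sen τ => φ x.2]
  congr 1
  ext m
  rw [tsum_map_mul]

/-- If a rank decreases with probability bounded below as long as the final state has not been
reached, then the final state is reached almost surely. -/
theorem reachProb_eq_one_of_rank [Finite S] [Finite A] [Finite Sen]
    (hsink : G.δ .final .chance = PMF.pure .final) {W : Set (Vertex S A Sen τ)}
    (hW : ∀ h, ∀ v ∈ W, ∀ m ∈ (nextMove π₁ π₂ h v).support, G.post v m ⊆ W)
    {r : Vertex S A Sen τ → ℕ} (hr : r .final = 0) {f : Vertex S A Sen τ → PMF (Move A Sen)}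
    (hf : ∀ h, ∀ v ∈ W, ¬ v.IsP2 → nextMove π₁ π₂ h v = f v)
    (h1 : ∀ v ∈ W, ¬ v.IsP2 → v ≠ .final → ∃ m ∈ (f v).support, ∃ w ∈ G.post v m, r w < r v)
    (h2 : ∀ h, ∀ v ∈ W, v.IsP2 → ∀ m ∈ (π₂ h v).support, ∃ w ∈ G.post v m, r w < r v)
    {q : Vertex S A Sen τ} (hq : q ∈ W) : G.reachProb π₁ π₂ q = 1 := by
  -- Off P2's positions the choice `f` is fixed, so the whole step, move and transition together,
  -- has finitely many possible probabilities.
  obtain ⟨c₁, hc₁, hc₁', hc₁g⟩ := exists_pos_le_of_ne_zero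
    fun x : Vertex S A Sen τ × Vertex S A Sen τ => ((f x.1).bind (G.δ x.1)) x.2
  obtain ⟨c₂, hc₂, hc₂', hc₂g⟩ := exists_pos_le_of_ne_zero
    fun x : Vertex S A Sen τ × Move A Sen × Vertex S A Sen τ => G.δ x.1 x.2.1 x.2.2
  obtain ⟨K, hK⟩ : ∃ K, ∀ v, r v ≤ K := by
    obtain ⟨K, hK⟩ := (Set.finite_range r).bddAbove
    exact ⟨K, fun v => hK ⟨v, rfl⟩⟩
  set β := min c₁ c₂ / 2 with hβdef
  have hβ : 0 < β := half_pos (lt_min hc₁ hc₂)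
  have hβ' : β ≤ 1 / 2 := by
    have := min_le_left c₁ c₂
    rw [hβdef]
    linarith
  have hβ₁ : 2 * β ≤ c₁ := by
    have := min_le_left c₁ c₂
    rw [hβdef]
    linarith
  have hβ₂ : 2 * β ≤ c₂ := by
    have := min_le_right c₁ c₂
    rw [hβdef]
    linarith
  set φ : Vertex S A Sen τ → ℝ≥0∞ := fun v => ENNReal.ofReal (1 - β ^ r v) with hφ
  set l := ENNReal.ofReal (1 - β ^ K) with hl
  have hl1 : l < 1 := by
    rw [hl, ENNReal.ofReal_lt_one]
    linarith [pow_pos hβ K]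
  have hfin0 : φ .final = 0 := by simp [hφ, hr]
  have hfinP1 : ¬ (Vertex.final : Vertex S A Sen τ).IsP1 := id
  have hfinP2 : ¬ (Vertex.final : Vertex S A Sen τ).IsP2 := id
  have step : ∀ h, ∀ v ∈ W,
      ∑' m, nextMove π₁ π₂ h v m * ∑' w, G.δ v m w * φ w ≤ l * φ v := by
    intro h v hv
    by_cases hvf : v = .final
    · subst hvf
      rw [nextMove_of_not hfinP1 hfinP2, tsum_pure_mul, hsink, tsum_pure_mul, hfin0]
      exact bot_le
    by_cases hv2 : v.IsP2
    · rw [nextMove_of_isP2 hv2]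
      refine tsum_mul_le_of_support _ _ _ fun m hm => ?_
      obtain ⟨w, hw, hwr⟩ := h2 h v hv hv2 m hm
      refine tsum_potential_le r hβ hβ' (hK v) _ hwr ?_
      exact (ENNReal.ofReal_le_ofReal hβ₂).trans
        (hc₂g (v, m, w) (((G.δ v m).mem_support_iff w).1 hw))
    · rw [hf h v hv hv2, ← tsum_bind_mul]
      obtain ⟨m, hm, w, hw, hwr⟩ := h1 v hv hv2 hvf
      refine tsum_potential_le r hβ hβ' (hK v) _ hwr ?_
      refine (ENNReal.ofReal_le_ofReal hβ₁).trans (hc₁g (v, w) ?_)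
      rw [← PMF.mem_support_iff, PMF.mem_support_bind_iff]
      exact ⟨m, hm, hw⟩
  -- The potential contracts by `l < 1` in each step, hence its expectation decays geometrically.
  have bound : ∀ n, ∑' x, G.playDist π₁ π₂ q n x * φ x.2 ≤ l ^ n := by
    intro n
    induction n with
    | zero =>
      rw [playDist, tsum_pure_mul _ fun x : History S A Sen τ × Vertex S A Sen τ => φ x.2, pow_zero,
        ← ENNReal.ofReal_one]
      exact ENNReal.ofReal_le_ofReal (by linarith [pow_pos hβ (r q)])
    | succ n ih =>
      rw [tsum_playDist_succ]
      calc _ ≤ ∑' x, G.playDist π₁ π₂ q n x * (l * φ x.2) := by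
            refine ENNReal.tsum_le_tsum fun x => ?_
            by_cases hx : G.playDist π₁ π₂ q n x = 0
            · simp [hx]
            · gcongr
              exact step _ _ (snd_mem_of_closed hW hq n x ((PMF.mem_support_iff _ _).2 hx))
        _ = l * ∑' x, G.playDist π₁ π₂ q n x * φ x.2 := by
            rw [← ENNReal.tsum_mul_left]
            congr 1
            ext x
            ring
        _ ≤ l * l ^ n := by gcongr
        _ = l ^ (n + 1) := (pow_succ' l n).symm
  -- Away from the final state the rank is positive, so the potential is at least `1 - β ≥ 1 / 2`.
  -- Twice its expectation therefore bounds the probability of not having arrived.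
  have lower : ∀ n, 1 ≤ G.reachProb π₁ π₂ q + 2 * l ^ n := by
    intro n
    calc (1 : ℝ≥0∞) = ∑' x, G.playDist π₁ π₂ q n x := (PMF.tsum_coe _).symm
      _ ≤ ∑' x, (G.playDist π₁ π₂ q n x * (if x.2 = .final then 1 else 0) +
            2 * (G.playDist π₁ π₂ q n x * φ x.2)) := by
          refine ENNReal.tsum_le_tsum fun x => ?_
          by_cases hx : G.playDist π₁ π₂ q n x = 0
          · simp [hx]
          by_cases hxf : x.2 = .final
          · simp [hxf]
          have hxW := snd_mem_of_closed hW hq n x ((PMF.mem_support_iff _ _).2 hx)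
          have hrank : r x.2 ≠ 0 := by
            by_cases hx2 : x.2.IsP2
            · obtain ⟨m, hm⟩ := (π₂ [] x.2).support_nonempty
              obtain ⟨w, -, hw⟩ := h2 [] x.2 hxW hx2 m hm
              omega
            · obtain ⟨m, -, w, -, hw⟩ := h1 x.2 hxW hx2 hxf
              omega
          have : (1 : ℝ≥0∞) ≤ 2 * φ x.2 := by
            have h3 : β ^ r x.2 ≤ β := pow_le_of_le_one hβ.le (by linarith) hrank
            have h4 : (2 : ℝ≥0∞) = ENNReal.ofReal 2 := by simp
            rw [hφ, h4, ← ENNReal.ofReal_mul (by norm_num), ENNReal.one_le_ofReal]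
            linarith
          calc _ = G.playDist π₁ π₂ q n x * 1 := (mul_one _).symm
            _ ≤ G.playDist π₁ π₂ q n x * (2 * φ x.2) := by gcongr
            _ = 2 * (G.playDist π₁ π₂ q n x * φ x.2) := by ring
            _ ≤ _ := le_add_self
      _ = G.stateDist π₁ π₂ q n .final + 2 * ∑' x, G.playDist π₁ π₂ q n x * φ x.2 := by
          rw [ENNReal.tsum_add, ENNReal.tsum_mul_left, stateDist, PMF.map_apply]
          congr 2
          ext x
          by_cases hx : x.2 = .final
          · simp [hx]
          · simp [hx, Ne.symm hx]
      _ ≤ _ := by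
          gcongr
          · exact le_iSup (fun n => G.stateDist π₁ π₂ q n .final) n
          · exact bound n
  refine le_antisymm (iSup_le fun n => PMF.coe_le_one _ _) ?_
  have lim : Filter.Tendsto (fun n => G.reachProb π₁ π₂ q + 2 * l ^ n) Filter.atTop
      (nhds (G.reachProb π₁ π₂ q + 2 * 0)) :=
    tendsto_const_nhds.add (ENNReal.Tendsto.const_mul
      (ENNReal.tendsto_pow_atTop_nhds_zero_of_lt_one hl1) (Or.inr (by simp)))
  simpa using ge_of_tendsto' lim lower

/-! ### Attractors -/

/-- The positions from which the final state can be approached in `n` rounds with positive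
probability, if P2 is restricted to the moves `R` and the moves `M` are made elsewhere. -/
def attr (G : Arena S A Sen τ) (M R : Vertex S A Sen τ → Set (Move A Sen)) :
    ℕ → Set (Vertex S A Sen τ)
  | 0 => {.final}
  | n + 1 => attr G M R n ∪ {v | if v.IsP2 then ∀ m ∈ R v, (G.post v m ∩ attr G M R n).Nonempty
      else ∃ m ∈ M v, (G.post v m ∩ attr G M R n).Nonempty}

/-- The positive attractor of the final state. -/
def attractor (G : Arena S A Sen τ) (M R : Vertex S A Sen τ → Set (Move A Sen)) :
    Set (Vertex S A Sen τ) :=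
  ⋃ n, G.attr M R n

variable {M R : Vertex S A Sen τ → Set (Move A Sen)}

theorem final_mem_attractor : .final ∈ G.attractor M R :=
  Set.mem_iUnion.2 ⟨0, rfl⟩

/-- An increasing chain of subsets of a finite set stabilizes. This yields one level `N` that serves
all moves of P2 at once. -/
theorem exists_attractor_eq_attr [Finite S] [Finite A] [Finite Sen] :
    ∃ N, G.attractor M R = G.attr M R N := by
  have hmono : Monotone (G.attr M R) := monotone_nat_of_le_succ fun n => Set.subset_union_left
  obtain ⟨N, hN⟩ := WellFoundedGT.monotone_chain_condition ⟨G.attr M R, hmono⟩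
  refine ⟨N, (Set.iUnion_subset fun n => ?_).antisymm (Set.subset_iUnion _ N)⟩
  rcases le_total N n with h | h
  · exact (hN n h).ge
  · exact hmono h

theorem exists_disjoint_of_notMem_attractor [Finite S] [Finite A] [Finite Sen]
    {v : Vertex S A Sen τ} (hv : v ∉ G.attractor M R) (h2 : v.IsP2) :
    ∃ m ∈ R v, Disjoint (G.post v m) (G.attractor M R) := by
  obtain ⟨N, hN⟩ := exists_attractor_eq_attr (G := G) (M := M) (R := R)
  by_contra hcon
  push Not at hcon
  -- If every move of P2 could hit the attractor, that is level `N`, then `v` would belong to level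
  -- `N + 1`.
  refine hv (Set.mem_iUnion.2 ⟨N + 1, Or.inr ?_⟩)
  simp only [Set.mem_ofPred_eq, if_pos h2]
  intro m hm
  have := hcon m hm
  rwa [Set.not_disjoint_iff_nonempty_inter, hN] at this

theorem disjoint_of_notMem_attractor {v : Vertex S A Sen τ} (hv : v ∉ G.attractor M R)
    (h2 : ¬ v.IsP2) {m : Move A Sen} (hm : m ∈ M v) :
    Disjoint (G.post v m) (G.attractor M R) := by
  by_contra hcon
  obtain ⟨w, hw, hw'⟩ := Set.not_disjoint_iff.1 hcon
  obtain ⟨n, hn⟩ := Set.mem_iUnion.1 hw'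
  refine hv (Set.mem_iUnion.2 ⟨n + 1, Or.inr ?_⟩)
  simp only [Set.mem_ofPred_eq, if_neg h2]
  exact ⟨m, hm, w, hw, hn⟩

/-- The rank is the first level at which a position appears; positions outside the attractor get the
default value `sInf ∅ = 0`, which does no harm as the successors provided lie inside. -/
theorem exists_rank_attractor (G : Arena S A Sen τ)
    (M R : Vertex S A Sen τ → Set (Move A Sen)) :
    ∃ r : Vertex S A Sen τ → ℕ, r .final = 0 ∧ ∀ v ∈ G.attractor M R, v ≠ .final →
      (v.IsP2 → ∀ m ∈ R v, ∃ w ∈ G.post v m, w ∈ G.attractor M R ∧ r w < r v) ∧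
      (¬ v.IsP2 → ∃ m ∈ M v, ∃ w ∈ G.post v m, w ∈ G.attractor M R ∧ r w < r v) := by
  refine ⟨fun v => sInf {n | v ∈ G.attr M R n}, Nat.sInf_eq_zero.2 (Or.inl rfl), ?_⟩
  intro v hv hvf
  obtain ⟨n, hn⟩ := Set.mem_iUnion.1 hv
  have hmin : v ∈ G.attr M R (sInf {n | v ∈ G.attr M R n}) :=
    Nat.sInf_mem (s := {n | v ∈ G.attr M R n}) ⟨n, hn⟩
  rcases hk : sInf {n | v ∈ G.attr M R n} with _ | k
  · rw [hk] at hmin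
    exact absurd hmin hvf
  rw [hk] at hmin
  have hnot : v ∉ G.attr M R k := fun h => by
    have : sInf {n | v ∈ G.attr M R n} ≤ k := Nat.sInf_le h
    omega
  have hmem := hmin.resolve_left hnot
  have hlt : ∀ w ∈ G.attr M R k,
      w ∈ G.attractor M R ∧ sInf {n | w ∈ G.attr M R n} < k + 1 := fun w hw =>
    ⟨Set.mem_iUnion.2 ⟨k, hw⟩, Nat.lt_succ_of_le (Nat.sInf_le hw)⟩
  simp only [hk]
  by_cases h2 : v.IsP2
  · simp only [Set.mem_ofPred_eq, if_pos h2] at hmem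
    refine ⟨fun _ m hm => ?_, fun h => absurd h2 h⟩
    obtain ⟨w, hw, hw'⟩ := hmem m hm
    exact ⟨w, hw, hlt w hw'⟩
  · simp only [Set.mem_ofPred_eq, if_neg h2] at hmem
    refine ⟨fun h => absurd h h2, fun _ => ?_⟩
    obtain ⟨m, hm, w, hw, hw'⟩ := hmem
    exact ⟨m, hm, w, hw, hlt w hw'⟩

/-- If a rank can decrease as long as the final state has not been reached, then the final state is
reached with positive probability. -/
theorem reachProb_pos_of_rank {W : Set (Vertex S A Sen τ)} {r : Vertex S A Sen τ → ℕ}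
    (h : ∀ h, ∀ v ∈ W, v ≠ .final → ∃ m ∈ (nextMove π₁ π₂ h v).support,
      ∃ w ∈ G.post v m, w ∈ W ∧ r w < r v)
    {q : Vertex S A Sen τ} (hq : q ∈ W) : 0 < G.reachProb π₁ π₂ q := by
  by_contra hcon
  have hzero : ∀ n, ∀ x ∈ (G.playDist π₁ π₂ q n).support, x.2 ≠ .final := by
    intro n x hx hxf
    refine hcon (lt_of_lt_of_le ?_ (le_iSup (fun n => G.stateDist π₁ π₂ q n .final) n))
    rw [pos_iff_ne_zero, ← PMF.mem_support_iff, mem_support_stateDist]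
    exact ⟨x, hx, hxf⟩
  -- If the final state were never reached, the rank could drop in every round, which is absurd
  -- after `r q + 1` rounds.
  have key : ∀ n, ∃ x ∈ (G.playDist π₁ π₂ q n).support, x.2 ∈ W ∧ r x.2 + n ≤ r q := by
    intro n
    induction n with
    | zero => exact ⟨([], q), by simp [playDist], hq, le_rfl⟩
    | succ n ih =>
      obtain ⟨x, hx, hxW, hxr⟩ := ih
      obtain ⟨m, hm, w, hw, hwW, hwr⟩ := h x.1 x.2 hxW (hzero n x hx)
      exact ⟨_, mem_support_playDist_succ.2 ⟨x, hx, m, hm, w, hw, rfl⟩, hwW, by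
        change r w + (n + 1) ≤ r q
        omega⟩
  obtain ⟨x, -, -, hx⟩ := key (r q + 1)
  omega

/-! ### Certificates for almost-sure winning -/

/-- The properties that all games considered here share. -/
structure Regular (G : Arena S A Sen τ) : Prop where
  final_mem : .final ∈ G.verts
  final_sink : G.δ .final .chance = PMF.pure .final
  avail_chance : ∀ v, ¬ v.IsP1 → ¬ v.IsP2 → G.avail v = {.chance}
  attack_nonempty : ∀ v ∈ G.verts, v.IsP2 → (G.avail v).Nonempty
  closed : ∀ v ∈ G.verts, ∀ m ∈ G.avail v, G.post v m ⊆ G.verts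
  mem_belief : ∀ {s B κ}, .p1 s B κ ∈ G.verts → s ∈ B
  belief : ∀ {s t B κ}, .p1 s B κ ∈ G.verts → t ∈ B → .p1 t B κ ∈ G.verts

/-- A certificate that the memoryless choices `f` win almost surely from `W` against the moves `R`
of P2: `W` is closed, and a rank can decrease in each step. -/
structure Certificate (G : Arena S A Sen τ) (R : Vertex S A Sen τ → Set (Move A Sen))
    (f : Vertex S A Sen τ → PMF (Move A Sen)) (W : Set (Vertex S A Sen τ))
    (r : Vertex S A Sen τ → ℕ) : Prop where
  subset : W ⊆ G.verts
  final_mem : .final ∈ W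
  rank_final : r .final = 0
  avail : ∀ v ∈ W, ¬ v.IsP2 → (f v).support ⊆ G.avail v
  closed₁ : ∀ v ∈ W, ¬ v.IsP2 → ∀ m ∈ (f v).support, G.post v m ⊆ W
  decr₁ : ∀ v ∈ W, ¬ v.IsP2 → v ≠ .final → ∃ m ∈ (f v).support, ∃ w ∈ G.post v m, r w < r v
  closed₂ : ∀ v ∈ W, v.IsP2 → ∀ m ∈ R v, G.post v m ⊆ W
  decr₂ : ∀ v ∈ W, v.IsP2 → ∀ m ∈ R v, ∃ w ∈ G.post v m, r w < r v

/-- On `W`, the choices `f` depend on P1's belief and on the counter only. -/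
def Uniform (f : Vertex S A Sen τ → PMF (Move A Sen)) (W : Set (Vertex S A Sen τ)) : Prop :=
  ∀ s t B κ, .p1 s B κ ∈ W → t ∈ B → .p1 t B κ ∈ W ∧ f (.p1 t B κ) = f (.p1 s B κ)

variable {f : Vertex S A Sen τ → PMF (Move A Sen)} {W : Set (Vertex S A Sen τ)}
  {r : Vertex S A Sen τ → ℕ}

theorem Certificate.nextMove_eq (hG : G.Regular) (hC : G.Certificate R f W r)
    (hπ : ∀ h, ∀ v ∈ W, v.IsP1 → π₁ h v = f v) (h : History S A Sen τ) {v : Vertex S A Sen τ}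
    (hv : v ∈ W) (h2 : ¬ v.IsP2) : nextMove π₁ π₂ h v = f v := by
  by_cases h1 : v.IsP1
  · rw [nextMove_of_isP1 h1, hπ h v hv h1]
  · have := hC.avail v hv h2
    rw [hG.avail_chance v h1 h2] at this
    rw [nextMove_of_not h1 h2, eq_pure_of_support_subset this]

theorem Certificate.closed (hG : G.Regular) (hC : G.Certificate R f W r)
    (hπ₁ : ∀ h, ∀ v ∈ W, v.IsP1 → π₁ h v = f v)
    (hπ₂ : ∀ h, ∀ v ∈ W, v.IsP2 → (π₂ h v).support ⊆ R v) (h : History S A Sen τ)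
    (v : Vertex S A Sen τ) (hv : v ∈ W) (m : Move A Sen)
    (hm : m ∈ (nextMove π₁ π₂ h v).support) : G.post v m ⊆ W := by
  by_cases h2 : v.IsP2
  · rw [nextMove_of_isP2 h2] at hm
    exact hC.closed₂ v hv h2 m (hπ₂ h v hv h2 hm)
  · rw [hC.nextMove_eq hG hπ₁ h hv h2] at hm
    exact hC.closed₁ v hv h2 m hm

theorem Certificate.reachProb_eq_one [Finite S] [Finite A] [Finite Sen] (hG : G.Regular)
    (hC : G.Certificate R f W r) (hπ₁ : ∀ h, ∀ v ∈ W, v.IsP1 → π₁ h v = f v)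
    (hπ₂ : ∀ h, ∀ v ∈ W, v.IsP2 → (π₂ h v).support ⊆ R v) {q : Vertex S A Sen τ} (hq : q ∈ W) :
    G.reachProb π₁ π₂ q = 1 :=
  reachProb_eq_one_of_rank hG.final_sink (hC.closed hG hπ₁ hπ₂) hC.rank_final
    (fun h _ hv h2 => hC.nextMove_eq hG hπ₁ h hv h2) hC.decr₁
    (fun h v hv h2 m hm => hC.decr₂ v hv h2 m (hπ₂ h v hv h2 hm)) hq

/-- Soundness of certificates. Uniformity is what turns `f` into a belief-based strategy and keeps
`W` closed under changing the true state within the belief. -/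
theorem Certificate.subset_winRegion [Finite S] [Finite A] [Finite Sen] (hG : G.Regular)
    (hC : G.Certificate R f W r) (hf : Uniform f W) {Opp : Set (Strategy S A Sen τ)}
    (hOpp : ∀ π ∈ Opp, ∀ h, ∀ v ∈ G.verts, v.IsP2 → (π h v).support ⊆ R v) :
    W ⊆ G.winRegion Opp := by
  intro q hq
  -- The choice is read off at an arbitrary representative state of the belief; by uniformity it
  -- does not matter which.
  let F : Set S → Counter τ → PMF (Move A Sen) := fun B κ =>
    if h : ∃ s ∈ B, (.p1 s B κ : Vertex S A Sen τ) ∈ W then f (.p1 h.choose B κ)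
    else PMF.pure .chance
  let π : Strategy S A Sen τ := fun _ v => match v with
    | .p1 _ B κ => F B κ
    | _ => PMF.pure .chance
  have hπ : ∀ h, ∀ v ∈ W, v.IsP1 → π h v = f v := by
    rintro h (⟨s, B, κ⟩ | _ | _ | _) hv h1
    · have hs : s ∈ B := hG.mem_belief (hC.subset hv)
      have hex : ∃ s ∈ B, (.p1 s B κ : Vertex S A Sen τ) ∈ W := ⟨s, hs, hv⟩
      change F B κ = _
      simp only [F, dif_pos hex]
      exact (hf s _ B κ hv hex.choose_spec.1).2
    all_goals exact absurd h1 id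
  refine ⟨hC.subset hq, π, ⟨F, fun h s B κ => rfl⟩, ?_⟩
  have hpos : ∀ v, G.Possible Opp π q v → v ∈ W := by
    intro v hv
    induction hv with
    | start => exact hq
    | @play v w π₂ n _ hπ₂ hw ih =>
      obtain ⟨x, hx, rfl⟩ := mem_support_stateDist.1 hw
      exact snd_mem_of_closed (hC.closed hG hπ fun h v hv => hOpp π₂ hπ₂ h v (hC.subset hv))
        ih n x hx
    | @belief s t B κ _ ht ih => exact (hf s t B κ ih ht).1
  refine fun v hv => ⟨fun h1 => ?_, fun π₂ hπ₂ => ?_⟩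
  · rw [hπ [] v (hpos v hv) h1]
    exact hC.avail v (hpos v hv) h1.not_isP2
  · exact hC.reachProb_eq_one hG hπ (fun h v hv => hOpp π₂ hπ₂ h v (hC.subset hv)) (hpos v hv)

/-- Completeness of certificates. The set `W` consists of the positions P1 has to reckon with, and
the rank comes from the positive attractor. The hypothesis `hrich` puts all memoryless strategies
with moves in `R` among the opponents: they realize each single move and the trap that P2 would have
outside the attractor. -/
theorem exists_certificate_of_mem_winRegion [Finite S] [Finite A] [Finite Sen] (hG : G.Regular)
    {Opp : Set (Strategy S A Sen τ)} (hne : ∀ v ∈ G.verts, v.IsP2 → (R v).Nonempty)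
    (hav : ∀ v ∈ G.verts, v.IsP2 → R v ⊆ G.avail v)
    (hOpp : ∀ π ∈ Opp, ∀ h, ∀ v ∈ G.verts, v.IsP2 → (π h v).support ⊆ R v)
    (hrich : ∀ p : Vertex S A Sen τ → PMF (Move A Sen),
      (∀ v ∈ G.verts, v.IsP2 → (p v).support ⊆ R v) → (fun _ => p) ∈ Opp)
    {q : Vertex S A Sen τ} (hq : q ∈ G.winRegion Opp) :
    ∃ f W r, q ∈ W ∧ G.Certificate R f W r ∧ Uniform f W := by
  obtain ⟨hqv, π, ⟨F, hF⟩, hwin⟩ := hq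
  set f : Vertex S A Sen τ → PMF (Move A Sen) := nextMove π π [] with hfdef
  have hf : ∀ (π₂ : Strategy S A Sen τ) h v, ¬ v.IsP2 → nextMove π π₂ h v = f v := by
    rintro π₂ h (⟨s, B, κ⟩ | _ | _ | _) h2
    · simp only [hfdef, nextMove, hF]
    · rfl
    · exact absurd trivial h2
    · rfl
  have hfav : ∀ v, G.Possible Opp π q v → ¬ v.IsP2 → (f v).support ⊆ G.avail v := by
    intro v hv h2
    by_cases h1 : v.IsP1
    · rw [hfdef, nextMove_of_isP1 h1]
      exact (hwin v hv).1 h1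
    · rw [hfdef, nextMove_of_not h1 h2, hG.avail_chance v h1 h2, PMF.support_pure]
  have hverts : ∀ v, G.Possible Opp π q v → v ∈ G.verts := by
    intro v hv
    induction hv with
    | start => exact hqv
    | @play v w π₂ n hpv hπ₂ hw ih =>
      have key : ∀ n, ∀ x ∈ (G.playDist π π₂ v n).support, x.2 ∈ G.verts := by
        intro n
        induction n with
        | zero =>
          intro x hx
          rw [playDist, PMF.support_pure] at hx
          rw [hx]
          exact ih
        | succ n ihn =>
          intro x hx
          obtain ⟨y, hy, m, hm, w, hw, rfl⟩ := mem_support_playDist_succ.1 hx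
          refine hG.closed y.2 (ihn y hy) m ?_ hw
          by_cases h2 : y.2.IsP2
          · rw [nextMove_of_isP2 h2] at hm
            exact hav _ (ihn y hy) h2 (hOpp π₂ hπ₂ _ _ (ihn y hy) h2 hm)
          · rw [hf _ _ _ h2] at hm
            exact hfav y.2 (hpv.play hπ₂ (mem_support_stateDist.2 ⟨y, hy, rfl⟩)) h2 hm
      obtain ⟨x, hx, rfl⟩ := mem_support_stateDist.1 hw
      exact key n x hx
    | belief _ ht ih => exact hG.belief ih ht
  have hone : ∀ {v w : Vertex S A Sen τ} {π₂ : Strategy S A Sen τ} {m : Move A Sen},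
      G.Possible Opp π q v → π₂ ∈ Opp → m ∈ (nextMove π π₂ [] v).support → w ∈ G.post v m →
      G.Possible Opp π q w := by
    intro v w π₂ m hv hπ₂ hm hw
    refine hv.play hπ₂ (n := 1) (mem_support_stateDist.2 ⟨([] ++ [(v, m)], w), ?_, rfl⟩)
    exact mem_support_playDist_succ.2 ⟨([], v), by simp [playDist], m, hm, w, hw, rfl⟩
  have : Nonempty (Move A Sen) := ⟨.chance⟩
  choose! a ha using hne
  let p₀ : Vertex S A Sen τ → PMF (Move A Sen) := fun v => PMF.pure (a v)
  have hp₀ : ∀ v ∈ G.verts, v.IsP2 → (p₀ v).support ⊆ R v := by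
    intro v hv h2
    simpa [p₀] using ha v hv h2
  let W : Set (Vertex S A Sen τ) := {v | G.Possible Opp π q v ∨ v = .final}
  have hfinP2 : ¬ (Vertex.final : Vertex S A Sen τ).IsP2 := id
  have hclosed₁ : ∀ v ∈ W, ¬ v.IsP2 → ∀ m ∈ (f v).support, G.post v m ⊆ W := by
    rintro v (hv | rfl) h2 m hm w hw
    · rw [← hf (fun _ => p₀) [] v h2] at hm
      exact Or.inl (hone hv (hrich p₀ hp₀) hm hw)
    · have hm' : m = .chance := by simpa [hfdef, nextMove] using hm
      rw [hm', post, hG.final_sink, PMF.support_pure] at hw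
      exact Or.inr hw
  have hclosed₂ : ∀ v ∈ W, v.IsP2 → ∀ m ∈ R v, G.post v m ⊆ W := by
    rintro v (hv | rfl) h2 m hm w hw
    -- The opponent that plays `m` at `v` and the default `p₀` elsewhere shows that the successors
    -- of `m` have to be reckoned with.
    · refine Or.inl (hone (π₂ := fun _ => Function.update p₀ v (PMF.pure m)) hv (hrich _ ?_) ?_ hw)
      · intro u hu hu2
        by_cases huv : u = v
        · subst huv
          simpa using hm
        · rw [Function.update_of_ne huv]
          exact hp₀ u hu hu2
      · rw [nextMove_of_isP2 h2, Function.update_self, PMF.support_pure]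
        rfl
    · exact absurd h2 hfinP2
  have hWT : W ⊆ G.attractor (fun v => (f v).support) R := by
    intro z hz
    by_contra hzT
    set T := G.attractor (fun v => (f v).support) R with hT
    have hesc : ∀ v, ∃ m, v ∉ T → v.IsP2 → m ∈ R v ∧ Disjoint (G.post v m) T := by
      intro v
      by_cases hv : v ∉ T ∧ v.IsP2
      · obtain ⟨m, hm⟩ := exists_disjoint_of_notMem_attractor hv.1 hv.2
        exact ⟨m, fun _ _ => hm⟩
      · exact ⟨.chance, fun h h' => absurd ⟨h, h'⟩ hv⟩
    choose b hb using hesc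
    -- P2 avoids the attractor whenever it is outside. P1's fixed choices cannot enter it either, so
    -- from `z` the final state would be reached with probability zero.
    let p : Vertex S A Sen τ → PMF (Move A Sen) := fun v =>
      if v ∉ T then PMF.pure (b v) else p₀ v
    have hp : (fun _ => p) ∈ Opp := by
      refine hrich p fun v hv h2 => ?_
      by_cases hvT : v ∉ T
      · simpa only [p, if_pos hvT, PMF.support_pure, Set.singleton_subset_iff] using (hb v hvT h2).1
      · simpa only [p, if_neg hvT] using hp₀ v hv h2
    have hzP : G.Possible Opp π q z := by
      rcases hz with hz | rfl
      · exact hz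
      · exact absurd final_mem_attractor hzT
    have h0 : G.reachProb π (fun _ => p) z = 0 := by
      refine reachProb_eq_zero_of_trap (Z := Tᶜ) (fun h => h final_mem_attractor) ?_ hzT
      intro h v hv m hm
      refine Set.disjoint_left.1 ?_
      by_cases h2 : v.IsP2
      · rw [nextMove_of_isP2 h2] at hm
        simp only [p, if_pos (show v ∉ T from hv), PMF.support_pure, Set.mem_singleton_iff] at hm
        rw [hm]
        exact (hb v hv h2).2
      · rw [hf _ _ _ h2] at hm
        exact disjoint_of_notMem_attractor hv h2 hm
    rw [(hwin z hzP).2 _ hp] at h0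
    exact one_ne_zero h0
  obtain ⟨r, hr0, hr⟩ := exists_rank_attractor G (fun v => (f v).support) R
  refine ⟨f, W, r, Or.inl .start, ⟨?_, Or.inr rfl, hr0, ?_, hclosed₁, ?_, hclosed₂, ?_⟩, ?_⟩
  · rintro v (hv | rfl)
    · exact hverts v hv
    · exact hG.final_mem
  · rintro v (hv | rfl) h2
    · exact hfav v hv h2
    · rw [hG.avail_chance _ id id]
      simp [hfdef, nextMove]
  · intro v hv h2 hvf
    obtain ⟨m, hm, w, hw, -, hwr⟩ := (hr v (hWT hv) hvf).2 h2
    exact ⟨m, hm, w, hw, hwr⟩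
  · intro v hv h2 m hm
    have hvf : v ≠ .final := fun h => hfinP2 (h ▸ h2)
    obtain ⟨w, hw, -, hwr⟩ := (hr v (hWT hv) hvf).1 h2 m hm
    exact ⟨w, hw, hwr⟩
  · rintro s t B κ (hs | hs) ht
    · exact ⟨Or.inl (hs.belief ht), by simp only [hfdef, nextMove, hF]⟩
    · cases hs

end Arena

/-! ### Gluing certificates. -/

namespace Arena

variable {G : Arena S A Sen τ} {R : Vertex S A Sen τ → Set (Move A Sen)}
  {f f₁ f₂ : Vertex S A Sen τ → PMF (Move A Sen)} {W W₁ W₂ : Set (Vertex S A Sen τ)}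
  {r r₁ r₂ : Vertex S A Sen τ → ℕ}

theorem post_nonempty (G : Arena S A Sen τ) (v : Vertex S A Sen τ) (m : Move A Sen) :
    (G.post v m).Nonempty :=
  (G.δ v m).support_nonempty

/-- The ranks outside `W₁` are shifted above all ranks `r₁`, so that entering `W₁` counts as
progress. Thus `W₂` need only be winning up to reaching `W₁`. -/
theorem Certificate.extend [Finite S] [Finite A] [Finite Sen] (hC : G.Certificate R f₁ W₁ r₁)
    (hsub : W₂ ⊆ G.verts)
    (havail : ∀ v ∈ W₂, v ∉ W₁ → ¬ v.IsP2 → (f₂ v).support ⊆ G.avail v)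
    (hclosed₁ : ∀ v ∈ W₂, v ∉ W₁ → ¬ v.IsP2 → ∀ m ∈ (f₂ v).support, G.post v m ⊆ W₁ ∪ W₂)
    (hdecr₁ : ∀ v ∈ W₂, v ∉ W₁ → ¬ v.IsP2 →
      ∃ m ∈ (f₂ v).support, ∃ w ∈ G.post v m, w ∈ W₁ ∨ r₂ w < r₂ v)
    (hclosed₂ : ∀ v ∈ W₂, v ∉ W₁ → v.IsP2 → ∀ m ∈ R v, G.post v m ⊆ W₁ ∪ W₂)
    (hdecr₂ : ∀ v ∈ W₂, v ∉ W₁ → v.IsP2 → ∀ m ∈ R v,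
      ∃ w ∈ G.post v m, w ∈ W₁ ∨ r₂ w < r₂ v) :
    ∃ r, G.Certificate R (W₁.piecewise f₁ f₂) (W₁ ∪ W₂) r := by
  obtain ⟨K, hK⟩ : ∃ K, ∀ v, r₁ v ≤ K := by
    obtain ⟨K, hK⟩ := (Set.finite_range r₁).bddAbove
    exact ⟨K, fun v => hK ⟨v, rfl⟩⟩
  have hlt : ∀ v w, v ∉ W₁ → (w ∈ W₁ ∨ r₂ w < r₂ v) →
      W₁.piecewise r₁ (fun v => K + 1 + r₂ v) w < W₁.piecewise r₁ (fun v => K + 1 + r₂ v) v := by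
    intro v w hv hw
    rw [Set.piecewise_eq_of_notMem _ _ _ hv]
    by_cases hw1 : w ∈ W₁
    · rw [Set.piecewise_eq_of_mem _ _ _ hw1]
      have := hK w
      omega
    · rw [Set.piecewise_eq_of_notMem _ _ _ hw1]
      have := hw.resolve_left hw1
      omega
  refine ⟨W₁.piecewise r₁ fun v => K + 1 + r₂ v, Set.union_subset hC.subset hsub,
    Or.inl hC.final_mem, ?_, ?_, ?_, ?_, ?_, ?_⟩
  · rw [Set.piecewise_eq_of_mem _ _ _ hC.final_mem, hC.rank_final]
  · intro v hv h2
    by_cases hv1 : v ∈ W₁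
    · rw [Set.piecewise_eq_of_mem _ _ _ hv1]
      exact hC.avail v hv1 h2
    · rw [Set.piecewise_eq_of_notMem _ _ _ hv1]
      exact havail v (hv.resolve_left hv1) hv1 h2
  · intro v hv h2 m hm
    by_cases hv1 : v ∈ W₁
    · rw [Set.piecewise_eq_of_mem _ _ _ hv1] at hm
      exact (hC.closed₁ v hv1 h2 m hm).trans Set.subset_union_left
    · rw [Set.piecewise_eq_of_notMem _ _ _ hv1] at hm
      exact hclosed₁ v (hv.resolve_left hv1) hv1 h2 m hm
  · intro v hv h2 hvf
    by_cases hv1 : v ∈ W₁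
    · rw [Set.piecewise_eq_of_mem _ _ _ hv1, Set.piecewise_eq_of_mem _ _ _ hv1]
      obtain ⟨m, hm, w, hw, hwr⟩ := hC.decr₁ v hv1 h2 hvf
      refine ⟨m, hm, w, hw, ?_⟩
      rwa [Set.piecewise_eq_of_mem _ _ _ (hC.closed₁ v hv1 h2 m hm hw)]
    · rw [Set.piecewise_eq_of_notMem _ f₁ _ hv1]
      obtain ⟨m, hm, w, hw, hwr⟩ := hdecr₁ v (hv.resolve_left hv1) hv1 h2
      exact ⟨m, hm, w, hw, hlt v w hv1 hwr⟩
  · intro v hv h2 m hm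
    by_cases hv1 : v ∈ W₁
    · exact (hC.closed₂ v hv1 h2 m hm).trans Set.subset_union_left
    · exact hclosed₂ v (hv.resolve_left hv1) hv1 h2 m hm
  · intro v hv h2 m hm
    by_cases hv1 : v ∈ W₁
    · obtain ⟨w, hw, hwr⟩ := hC.decr₂ v hv1 h2 m hm
      refine ⟨w, hw, ?_⟩
      rwa [Set.piecewise_eq_of_mem _ _ _ hv1,
        Set.piecewise_eq_of_mem _ _ _ (hC.closed₂ v hv1 h2 m hm hw)]
    · obtain ⟨w, hw, hwr⟩ := hdecr₂ v (hv.resolve_left hv1) hv1 h2 m hm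
      exact ⟨w, hw, hlt v w hv1 hwr⟩

theorem Certificate.union [Finite S] [Finite A] [Finite Sen] (h₁ : G.Certificate R f₁ W₁ r₁)
    (h₂ : G.Certificate R f₂ W₂ r₂) :
    ∃ r, G.Certificate R (W₁.piecewise f₁ f₂) (W₁ ∪ W₂) r := by
  refine h₁.extend (r₂ := r₂) h₂.subset (fun v hv _ => h₂.avail v hv)
    (fun v hv _ h2 m hm => (h₂.closed₁ v hv h2 m hm).trans Set.subset_union_right) ?_
    (fun v hv _ h2 m hm => (h₂.closed₂ v hv h2 m hm).trans Set.subset_union_right) ?_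
  · intro v hv hv1 h2
    obtain ⟨m, hm, w, hw, hwr⟩ := h₂.decr₁ v hv h2 fun h => hv1 (h ▸ h₁.final_mem)
    exact ⟨m, hm, w, hw, Or.inr hwr⟩
  · intro v hv hv1 h2 m hm
    obtain ⟨w, hw, hwr⟩ := h₂.decr₂ v hv h2 m hm
    exact ⟨w, hw, Or.inr hwr⟩

/-- At P1's positions, `W₁` contains either all states of a belief or none, so the case distinction
in the glued choice can be made by P1. -/
theorem Uniform.union (h₁ : Uniform f₁ W₁) (h₂ : Uniform f₂ W₂)
    (hmem : ∀ {s B κ}, .p1 s B κ ∈ W₂ → s ∈ B) :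
    Uniform (W₁.piecewise f₁ f₂) (W₁ ∪ W₂) := by
  intro s t B κ hs ht
  by_cases hs1 : (.p1 s B κ : Vertex S A Sen τ) ∈ W₁
  · obtain ⟨ht1, heq⟩ := h₁ s t B κ hs1 ht
    exact ⟨Or.inl ht1, by
      rw [Set.piecewise_eq_of_mem _ _ _ hs1, Set.piecewise_eq_of_mem _ _ _ ht1, heq]⟩
  · have hs2 := hs.resolve_left hs1
    obtain ⟨ht2, heq⟩ := h₂ s t B κ hs2 ht
    have ht1 : (.p1 t B κ : Vertex S A Sen τ) ∉ W₁ := fun h => hs1 (h₁ t s B κ h (hmem hs2)).1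
    exact ⟨Or.inr ht2, by
      rw [Set.piecewise_eq_of_notMem _ _ _ hs1, Set.piecewise_eq_of_notMem _ _ _ ht1, heq]⟩

theorem Regular.certificate_final (hG : G.Regular) :
    G.Certificate R (fun _ => PMF.pure .chance) {.final} fun _ => 0 := by
  refine ⟨by simpa using hG.final_mem, rfl, rfl, ?_, ?_, ?_, ?_, ?_⟩
  · rintro v rfl h2
    rw [hG.avail_chance _ id id, PMF.support_pure]
  · rintro v rfl h2 m hm
    rw [PMF.support_pure, Set.mem_singleton_iff] at hm
    rw [hm, post, hG.final_sink, PMF.support_pure]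
  · rintro v rfl h2 hf
    exact absurd rfl hf
  · rintro v rfl h2
    exact absurd h2 id
  · rintro v rfl h2
    exact absurd h2 id

/-! ### The winning regions -/

theorem exists_certificate_of_mem_ASW1 [Finite S] [Finite A] [Finite Sen] (hG : G.Regular)
    {q : Vertex S A Sen τ} (hq : q ∈ G.ASW1) :
    ∃ f W r, q ∈ W ∧ G.Certificate G.avail f W r ∧ Uniform f W :=
  exists_certificate_of_mem_winRegion (Opp := G.strategies2) hG hG.attack_nonempty (fun _ _ _ => subset_rfl)
    (fun _ hπ h v hv h2 => hπ h v hv h2) (fun _ hp _ v hv h2 => hp v hv h2) hq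

/-- A single belief-based choice of moves wins from the whole almost-sure winning region of P1. -/
theorem exists_certificate_ASW1 [Finite S] [Finite A] [Finite Sen] (hG : G.Regular) :
    ∃ f r, G.Certificate G.avail f G.ASW1 r ∧ Uniform f G.ASW1 := by
  let C : Set (Set (Vertex S A Sen τ)) :=
    {W | ∃ f r, G.Certificate G.avail f W r ∧ Uniform f W}
  have hne : C.Nonempty :=
    ⟨{.final}, _, _, hG.certificate_final, fun s t B κ hs => by cases hs⟩
  -- A maximal set with a uniform certificate absorbs every other one, since the union of two is
  -- again such a set.
  obtain ⟨W, hW⟩ := C.toFinite.exists_maximal hne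
  obtain ⟨f, r, hC, hf⟩ := hW.prop
  have hWeq : W = G.ASW1 := by
    refine (hC.subset_winRegion (Opp := G.strategies2) hG hf
      fun π hπ h v hv h2 => hπ h v hv h2).antisymm fun q hq => ?_
    obtain ⟨f', W', r', hqW, hC', hf'⟩ := exists_certificate_of_mem_ASW1 hG hq
    obtain ⟨r'', hC''⟩ := hC.union hC'
    have hmem : W ∪ W' ∈ C :=
      ⟨_, r'', hC'', hf.union hf' fun h => hG.mem_belief (hC'.subset h)⟩
    exact hW.le_of_ge hmem Set.subset_union_left (Or.inr hqW)
  exact ⟨f, r, hWeq ▸ hC, hWeq ▸ hf⟩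

/-- P1 has a move that it can use at each of its positions. -/
def QueryNonempty (G : Arena S A Sen τ) : Prop :=
  ∀ v ∈ G.verts, v.IsP1 → (G.avail v).Nonempty

/-- Determinacy for reaching with positive probability. Inside the attractor P1 follows the rank,
which may use the true state since `ASW2` quantifies over all strategies of P1. Outside it P2 can
keep the play away from the attractor. -/
theorem ASW2_eq [Finite S] [Finite A] [Finite Sen] (hG : G.Regular) (hne : G.QueryNonempty) :
    G.ASW2 = G.verts \ G.attractor G.avail G.avail := by
  have : Nonempty (Move A Sen) := ⟨.chance⟩
  set T := G.attractor G.avail G.avail with hT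
  ext q
  constructor
  · rintro ⟨hq, π₂, hπ₂, hzero⟩
    refine ⟨hq, fun hqT => ?_⟩
    obtain ⟨r, hr0, hr⟩ := exists_rank_attractor G G.avail G.avail
    choose! a ha using hne
    have hex : ∀ v, ∃ m, (v ∈ G.verts → v.IsP1 → m ∈ G.avail v) ∧
        (v ∈ T → v ≠ .final → v.IsP1 → ∃ w ∈ G.post v m, w ∈ T ∧ r w < r v) := by
      intro v
      by_cases hv : v ∈ T ∧ v ≠ .final ∧ v.IsP1
      · obtain ⟨m, hm, hw⟩ := (hr v hv.1 hv.2.1).2 hv.2.2.not_isP2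
        exact ⟨m, fun _ _ => hm, fun _ _ _ => hw⟩
      · exact ⟨a v, ha v, fun h1 h2 h3 => absurd ⟨h1, h2, h3⟩ hv⟩
    choose b hb hb' using hex
    have hπ₁ : (fun _ v => PMF.pure (b v)) ∈ G.strategies1 := by
      intro h v hv h1
      simpa using hb v hv h1
    refine (reachProb_pos_of_rank (G := G) (π₁ := fun _ v => PMF.pure (b v)) (π₂ := π₂)
      (W := T ∩ G.verts) (r := r) ?_ ⟨hqT, hq⟩).ne' (hzero _ hπ₁)
    rintro h v ⟨hvT, hv⟩ hvf
    by_cases h2 : v.IsP2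
    · rw [nextMove_of_isP2 h2]
      obtain ⟨m, hm⟩ := (π₂ h v).support_nonempty
      have hmav := hπ₂ h v hv h2 hm
      obtain ⟨w, hw, hwT, hwr⟩ := (hr v hvT hvf).1 h2 m hmav
      exact ⟨m, hm, w, hw, ⟨hwT, hG.closed v hv m hmav hw⟩, hwr⟩
    by_cases h1 : v.IsP1
    · rw [nextMove_of_isP1 h1, PMF.support_pure]
      obtain ⟨w, hw, hwT, hwr⟩ := hb' v hvT hvf h1
      exact ⟨b v, rfl, w, hw, ⟨hwT, hG.closed v hv _ (hb v hv h1) hw⟩, hwr⟩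
    · obtain ⟨m, hm, w, hw, hwT, hwr⟩ := (hr v hvT hvf).2 h2
      have hm' := hm
      rw [hG.avail_chance v h1 h2] at hm'
      rw [nextMove_of_not h1 h2, PMF.support_pure]
      exact ⟨m, hm', w, hw, ⟨hwT, hG.closed v hv m hm hw⟩, hwr⟩
  · rintro ⟨hq, hqT⟩
    have hex : ∀ v, ∃ m, (v ∈ G.verts → v.IsP2 → m ∈ G.avail v) ∧
        (v ∉ T → v.IsP2 → Disjoint (G.post v m) T) := by
      intro v
      by_cases hv : v ∉ T ∧ v.IsP2
      · obtain ⟨m, hm, hd⟩ := exists_disjoint_of_notMem_attractor hv.1 hv.2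
        exact ⟨m, fun _ _ => hm, fun _ _ => hd⟩
      · by_cases hv' : v ∈ G.verts ∧ v.IsP2
        · obtain ⟨m, hm⟩ := hG.attack_nonempty v hv'.1 hv'.2
          exact ⟨m, fun _ _ => hm, fun h h' => absurd ⟨h, h'⟩ hv⟩
        · exact ⟨.chance, fun h h' => absurd ⟨h, h'⟩ hv', fun h h' => absurd ⟨h, h'⟩ hv⟩
    choose b hb hb' using hex
    refine ⟨hq, fun _ v => PMF.pure (b v), fun h v hv h2 => by simpa using hb v hv h2, ?_⟩
    intro π₁ hπ₁
    refine reachProb_eq_zero_of_trap (Z := G.verts \ T) (fun h => h.2 final_mem_attractor) ?_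
      ⟨hq, hqT⟩
    rintro h v ⟨hv, hvT⟩ m hm
    by_cases h2 : v.IsP2
    · rw [nextMove_of_isP2 h2, PMF.support_pure, Set.mem_singleton_iff] at hm
      rw [hm]
      exact fun w hw => ⟨hG.closed v hv _ (hb v hv h2) hw, Set.disjoint_left.1 (hb' v hvT h2) hw⟩
    · have hmav : m ∈ G.avail v := by
        by_cases h1 : v.IsP1
        · rw [nextMove_of_isP1 h1] at hm
          exact hπ₁ h v hv h1 hm
        · rw [nextMove_of_not h1 h2, PMF.support_pure] at hm
          rwa [hG.avail_chance v h1 h2]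
      exact fun w hw => ⟨hG.closed v hv m hmav hw,
        Set.disjoint_left.1 (disjoint_of_notMem_attractor hvT h2 hmav) hw⟩

theorem final_notMem_ASW2 [Finite S] [Finite A] [Finite Sen] (hG : G.Regular)
    (hne : G.QueryNonempty) : .final ∉ G.ASW2 := by
  rw [ASW2_eq hG hne]
  exact fun h => h.2 final_mem_attractor

theorem post_subset_ASW2 [Finite S] [Finite A] [Finite Sen] (hG : G.Regular)
    (hne : G.QueryNonempty) {v : Vertex S A Sen τ} (hv : v ∈ G.ASW2) (h2 : ¬ v.IsP2)
    {m : Move A Sen} (hm : m ∈ G.avail v) : G.post v m ⊆ G.ASW2 := by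
  rw [ASW2_eq hG hne] at hv ⊢
  exact fun w hw => ⟨hG.closed v hv.1 m hm hw,
    Set.disjoint_left.1 (disjoint_of_notMem_attractor hv.2 h2 hm) hw⟩

theorem exists_post_subset_ASW2 [Finite S] [Finite A] [Finite Sen] (hG : G.Regular)
    (hne : G.QueryNonempty) {v : Vertex S A Sen τ} (hv : v ∈ G.ASW2) (h2 : v.IsP2) :
    ∃ m ∈ G.avail v, G.post v m ⊆ G.ASW2 := by
  rw [ASW2_eq hG hne] at hv ⊢
  obtain ⟨m, hm, hd⟩ := exists_disjoint_of_notMem_attractor hv.2 h2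
  exact ⟨m, hm, fun w hw => ⟨hG.closed v hv.1 m hm hw, Set.disjoint_left.1 hd hw⟩⟩

/-- The choices `f` defeat every strategy of P2 from `W`. Off `W` they are completed by arbitrary
available moves to obtain a legal strategy. -/
theorem Certificate.notMem_PWin2 [Finite S] [Finite A] [Finite Sen] (hG : G.Regular)
    (hne : G.QueryNonempty) (hC : G.Certificate G.avail f W r) {v : Vertex S A Sen τ}
    (hv : v ∈ W) : v ∉ G.PWin2 := by
  have : Nonempty (Move A Sen) := ⟨.chance⟩
  rintro ⟨-, π₂, hπ₂, hlt⟩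
  choose! a ha using hne
  refine (hlt (fun _ v => if v ∈ W then f v else PMF.pure (a v)) ?_).ne ?_
  · intro h u hu h1
    by_cases huW : u ∈ W
    · simpa only [if_pos huW] using hC.avail u huW h1.not_isP2
    · simpa only [if_neg huW, PMF.support_pure, Set.singleton_subset_iff] using ha u hu h1
  · exact hC.reachProb_eq_one hG (fun h u hu _ => if_pos hu)
      (fun h u hu h2 => hπ₂ h u (hC.subset hu) h2) hv

/-! ### Subjectively rationalizable moves. -/

theorem SR2_subset_avail (v : Vertex S A Sen τ) : G.SR2 v ⊆ G.avail v := by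
  unfold SR2
  split_ifs
  · exact Set.sep_subset _ _
  · exact Set.sep_subset _ _
  · exact subset_rfl

theorem SR1_subset_avail (v : Vertex S A Sen τ) : G.SR1 v ⊆ G.avail v := by
  unfold SR1
  split_ifs
  · exact Set.sep_subset _ _
  · exact Set.sep_subset _ _
  · exact subset_rfl

theorem SR2_nonempty [Finite S] [Finite A] [Finite Sen] (hG : G.Regular)
    (hne : G.QueryNonempty) {v : Vertex S A Sen τ} (hv : v ∈ G.verts) (h2 : v.IsP2) :
    (G.SR2 v).Nonempty := by
  unfold SR2
  split_ifs with hv2 hvp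
  · exact exists_post_subset_ASW2 hG hne hv2 h2
  · by_contra hcon
    have hall : ∀ m ∈ G.avail v, G.post v m ⊆ G.ASW1 := fun m hm => by
      by_contra hm'
      exact hcon ⟨m, hm, hm'⟩
    obtain ⟨f, r, hC, -⟩ := exists_certificate_ASW1 hG
    -- If all moves led into P1's winning region, `v` could be added to its certificate,
    -- contradicting `v ∈ G.PWin2`. As `v` belongs to P2, the choice `f` there is irrelevant.
    obtain ⟨r', hC'⟩ := hC.extend (W₂ := {v}) (f₂ := f) (r₂ := fun _ => 0) (by simpa using hv)
      (by rintro _ rfl - h; exact absurd h2 h) (by rintro _ rfl - h; exact absurd h2 h)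
      (by rintro _ rfl - h; exact absurd h2 h)
      (by rintro _ rfl - - m hm; exact (hall m hm).trans Set.subset_union_left)
      (by
        rintro u rfl - - m hm
        obtain ⟨w, hw⟩ := G.post_nonempty u m
        exact ⟨w, hw, Or.inl (hall m hm hw)⟩)
    exact hC'.notMem_PWin2 hG hne (Or.inr rfl) hvp
  · exact hG.attack_nonempty v hv h2

/-- In `ASW2` neither P1's moves nor P2's rationalizable ones leave that region. The rank would thus
decrease for ever without reaching the final state, which is not in `ASW2`. -/
theorem Certificate.notMem_ASW2 [Finite S] [Finite A] [Finite Sen] (hG : G.Regular)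
    (hne : G.QueryNonempty) (hC : G.Certificate G.SR2 f W r) {v : Vertex S A Sen τ}
    (hv : v ∈ W) : v ∉ G.ASW2 := by
  induction hn : r v using Nat.strong_induction_on generalizing v with
  | _ n ih =>
    intro hv2
    by_cases h2 : v.IsP2
    · obtain ⟨m, hm⟩ := SR2_nonempty hG hne (hC.subset hv) h2
      obtain ⟨w, hw, hwr⟩ := hC.decr₂ v hv h2 m hm
      refine ih (r w) (hn ▸ hwr) (hC.closed₂ v hv h2 m hm hw) rfl ?_
      rw [SR2, if_pos hv2] at hm
      exact hm.2 hw
    · have hvf : v ≠ .final := fun h => final_notMem_ASW2 hG hne (h ▸ hv2)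
      obtain ⟨m, hm, w, hw, hwr⟩ := hC.decr₁ v hv h2 hvf
      exact ih (r w) (hn ▸ hwr) (hC.closed₁ v hv h2 m hm hw) rfl
        (post_subset_ASW2 hG hne hv2 h2 (hC.avail v hv h2 hm) hw)

/-- If P1 wins against the subjectively rationalizable moves of P2, then P2 has no others. -/
theorem Certificate.of_SR2 [Finite S] [Finite A] [Finite Sen] (hG : G.Regular)
    (hne : G.QueryNonempty) (hC : G.Certificate G.SR2 f W r) : G.Certificate G.avail f W r := by
  obtain ⟨f₁, r₁, hC₁, -⟩ := exists_certificate_ASW1 hG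
  have hmove : ∀ v ∈ W, v.IsP2 → ∀ m ∈ G.avail v, m ∈ G.SR2 v ∨ G.post v m ⊆ G.ASW1 := by
    intro v hv h2 m hm
    by_cases hsub : G.post v m ⊆ G.ASW1
    · exact Or.inr hsub
    · left
      rw [SR2, if_neg (hC.notMem_ASW2 hG hne hv)]
      split_ifs
      · exact ⟨hm, hsub⟩
      · exact hm
  -- Moves outside `SR2` enter `ASW1`, where its own certificate takes over, so P1 wins from `W`
  -- against all moves.
  obtain ⟨r', hC'⟩ := hC₁.extend (W₂ := W) (f₂ := f) (r₂ := r) hC.subset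
    (fun v hv _ => hC.avail v hv)
    (fun v hv _ h2 m hm => (hC.closed₁ v hv h2 m hm).trans Set.subset_union_right)
    (by
      intro v hv hv1 h2
      obtain ⟨m, hm, w, hw, hwr⟩ := hC.decr₁ v hv h2 fun h => hv1 (h ▸ hC₁.final_mem)
      exact ⟨m, hm, w, hw, Or.inr hwr⟩)
    (by
      intro v hv hv1 h2 m hm
      rcases hmove v hv h2 m hm with h | h
      · exact (hC.closed₂ v hv h2 m h).trans Set.subset_union_right
      · exact h.trans Set.subset_union_left)
    (by
      intro v hv hv1 h2 m hm
      rcases hmove v hv h2 m hm with h | h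
      · obtain ⟨w, hw, hwr⟩ := hC.decr₂ v hv h2 m h
        exact ⟨w, hw, Or.inr hwr⟩
      · obtain ⟨w, hw⟩ := G.post_nonempty v m
        exact ⟨w, hw, Or.inl (h hw)⟩)
  -- Now `W` misses `PWin2` as well, and only the third case of `SR2` remains. The glued certificate
  -- has served its purpose: the original `f` and `r` are kept.
  have hSR : ∀ v ∈ W, G.SR2 v = G.avail v := by
    intro v hv
    rw [SR2, if_neg (hC.notMem_ASW2 hG hne hv), if_neg (hC'.notMem_PWin2 hG hne (Or.inr hv))]
  exact ⟨hC.subset, hC.final_mem, hC.rank_final, hC.avail, hC.closed₁, hC.decr₁,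
    fun v hv h2 m hm => hC.closed₂ v hv h2 m (hSR v hv ▸ hm),
    fun v hv h2 m hm => hC.decr₂ v hv h2 m (hSR v hv ▸ hm)⟩

/-! ### Passing certificates between games with common transitions. -/

theorem Certificate.transfer {G' : Arena S A Sen τ} {R' : Vertex S A Sen τ → Set (Move A Sen)}
    (hC : G.Certificate R f W r) (hδ : G'.δ = G.δ) (hsub : W ⊆ G'.verts)
    (hav : ∀ v ∈ W, ¬ v.IsP2 → G.avail v ⊆ G'.avail v) (hR : ∀ v ∈ W, v.IsP2 → R' v ⊆ R v) :
    G'.Certificate R' f W r := by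
  have hpost : G'.post = G.post := by
    funext v m
    simp only [post, hδ]
  refine ⟨hsub, hC.final_mem, hC.rank_final, fun v hv h2 => (hC.avail v hv h2).trans (hav v hv h2),
    ?_, ?_, fun v hv h2 m hm => ?_, fun v hv h2 m hm => ?_⟩
  · rw [hpost]
    exact hC.closed₁
  · rw [hpost]
    exact hC.decr₁
  · rw [hpost]
    exact hC.closed₂ v hv h2 m (hR v hv h2 hm)
  · rw [hpost]
    exact hC.decr₂ v hv h2 m (hR v hv h2 hm)

end Arena

namespace Arena

theorem Certificate.restrict {G G' : Arena S A Sen τ} {R R' : Vertex S A Sen τ → Set (Move A Sen)}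
    {f : Vertex S A Sen τ → PMF (Move A Sen)} {W : Set (Vertex S A Sen τ)}
    {r : Vertex S A Sen τ → ℕ} (hC : G.Certificate R f W r) (hG' : G'.Regular) (hδ : G'.δ = G.δ)
    (hav : ∀ v ∈ G'.verts, ¬ v.IsP2 → G.avail v ⊆ G'.avail v)
    (hR : ∀ v ∈ G'.verts, v.IsP2 → R' v ⊆ R v)
    (hR' : ∀ v ∈ G'.verts, v.IsP2 → R' v ⊆ G'.avail v) :
    G'.Certificate R' f (W ∩ G'.verts) r := by
  have hpost : ∀ v m, G'.post v m = G.post v m := by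
    intro v m
    simp only [post, hδ]
  refine ⟨Set.inter_subset_right, ⟨hC.final_mem, hG'.final_mem⟩, hC.rank_final,
    fun v hv h2 => (hC.avail v hv.1 h2).trans (hav v hv.2 h2), fun v hv h2 m hm => ?_,
    fun v hv h2 hvf => ?_, fun v hv h2 m hm => ?_, fun v hv h2 m hm => ?_⟩
  · exact Set.subset_inter (hpost v m ▸ hC.closed₁ v hv.1 h2 m hm)
      (hG'.closed v hv.2 m (hav v hv.2 h2 (hC.avail v hv.1 h2 hm)))
  · obtain ⟨m, hm, w, hw, hwr⟩ := hC.decr₁ v hv.1 h2 hvf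
    exact ⟨m, hm, w, (hpost v m).symm ▸ hw, hwr⟩
  · exact Set.subset_inter (hpost v m ▸ hC.closed₂ v hv.1 h2 m (hR v hv.2 h2 hm))
      (hG'.closed v hv.2 m (hR' v hv.2 h2 hm))
  · obtain ⟨w, hw, hwr⟩ := hC.decr₂ v hv.1 h2 m (hR v hv.2 h2 hm)
    exact ⟨w, (hpost v m).symm ▸ hw, hwr⟩

/-- A rank cannot decrease at a sink. This excludes the artificial sinks of `G⁰` from P1's winning
region. -/
theorem Certificate.not_sink {G : Arena S A Sen τ} {f : Vertex S A Sen τ → PMF (Move A Sen)}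
    {W : Set (Vertex S A Sen τ)} {r : Vertex S A Sen τ → ℕ} (hC : G.Certificate G.avail f W r)
    (hG : G.Regular) {v : Vertex S A Sen τ} (hv : v ∈ W) (hvf : v ≠ .final) :
    ¬ ∀ m, G.δ v m = PMF.pure v := by
  intro hsink
  have hpost : ∀ {m w}, w ∈ G.post v m → w = v := by
    intro m w hw
    simpa [post, hsink] using hw
  by_cases h2 : v.IsP2
  · obtain ⟨m, hm⟩ := hG.attack_nonempty v (hC.subset hv) h2
    obtain ⟨w, hw, hwr⟩ := hC.decr₂ v hv h2 m hm
    exact hwr.ne (congrArg r (hpost hw))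
  · obtain ⟨m, -, w, hw, hwr⟩ := hC.decr₁ v hv h2 hvf
    exact hwr.ne (congrArg r (hpost hw))

end Arena

namespace SensorGame

open Arena

variable (G : SensorGame S A Sen) {ε : ℝ≥0} (hε : ε ≤ 1)

/-! ### Moves and transitions of the sensor-revealing game -/

theorem nextCounter_of_notMem {γ : Set Sen} {κ : Counter τ} (hκ : (κ : ℤ) = -1)
    (hγ : G.hidden ∉ γ) : G.nextCounter γ κ = κ := by
  rw [nextCounter, if_pos ⟨hκ, hγ⟩]

theorem nextCounter_of_mem {γ : Set Sen} {κ : Counter τ} (hκ : (κ : ℤ) = -1)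
    (hγ : G.hidden ∈ γ) : (G.nextCounter γ κ : ℤ) = 0 := by
  have h : (κ : ℤ) < τ := by omega
  rw [nextCounter, if_neg fun h => h.2 hγ, dif_pos h]
  simp [hκ]

theorem nextCounter_nonneg {γ : Set Sen} {κ : Counter τ} (hκ : 0 ≤ (κ : ℤ)) :
    0 ≤ (G.nextCounter γ κ : ℤ) := by
  rw [nextCounter, if_neg fun h => by omega]
  split_ifs
  · change 0 ≤ (κ : ℤ) + 1
    omega
  · exact hκ

theorem counter_nonneg {κ : Counter τ} (hκ : (κ : ℤ) ≠ -1) : 0 ≤ (κ : ℤ) := by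
  have := κ.2.1
  omega

theorem exists_mem_moves_p1 (s : S) (B : Set S) (κ : Counter τ) :
    ∃ a : A, ∃ γ ∈ G.query, G.hidden ∉ γ ∧ Move.control a γ ∈ G.moves (.p1 s B κ) := by
  obtain ⟨a⟩ := G.exists_action
  obtain ⟨γ, hγ, hh⟩ := G.exists_query
  exact ⟨a, γ, hγ, hh, a, γ, hγ, rfl⟩

theorem mem_support_trans_p1 {s : S} {B : Set S} {κ : Counter τ} {a : A} {γ : Set Sen}
    {w : Vertex S A Sen τ} (hw : w ∈ (G.trans ε hε (.p1 s B κ) (.control a γ)).support) :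
    w = .nature s (G.post B a) a γ (G.nextCounter γ κ) := by
  simpa only [trans, PMF.support_pure, Set.mem_singleton_iff] using hw

theorem mem_support_trans_nature {s : S} {B : Set S} {κ : Counter τ} {a : A} {γ : Set Sen}
    {w : Vertex S A Sen τ} (hw : w ∈ (G.trans ε hε (.nature s B a γ κ) .chance).support) :
    w = .final ∨ ∃ s' ∈ G.post {s} a, w = .p2 s' B γ κ := by
  have hmap : w ∈ ((G.P s a).map fun s' => (.p2 s' B γ κ : Vertex S A Sen τ)).support →
      ∃ s' ∈ G.post {s} a, w = .p2 s' B γ κ := by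
    intro h
    rw [PMF.mem_support_map_iff] at h
    obtain ⟨s', hs', rfl⟩ := h
    exact ⟨s', ⟨s, rfl, (PMF.mem_support_iff _ _).1 hs'⟩, rfl⟩
  simp only [trans] at hw
  split_ifs at hw
  · left
    simpa using hw
  · exact Or.inr (hmap hw)
  · rw [mix, PMF.mem_support_bind_iff] at hw
    obtain ⟨b, -, hb⟩ := hw
    cases b
    · exact Or.inr (hmap hb)
    · left
      simpa using hb

theorem mem_support_trans_p2 {s : S} {B : Set S} {κ : Counter τ} {γ γ₂ : Set Sen}
    {w : Vertex S A Sen τ} (hw : w ∈ (G.trans ε hε (.p2 s B γ κ) (.attack γ₂)).support) :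
    w = .p1 s (B ∩ G.obs s γ γ₂) κ := by
  simpa only [trans, PMF.support_pure, Set.mem_singleton_iff] using hw

theorem trans_final (m : Move A Sen) :
    G.trans ε hε (.final : Vertex S A Sen τ) m = PMF.pure .final := by
  cases m <;> rfl

theorem post_singleton_subset {s : S} {B : Set S} (hs : s ∈ B) (a : A) :
    G.post {s} a ⊆ G.post B a := by
  rintro s' ⟨_, rfl, h⟩
  exact ⟨_, hs, h⟩

theorem regular_revealingGame : (G.revealingGame ε hε τ).Regular where
  final_mem := trivial
  final_sink := G.trans_final hε .chance
  avail_chance := by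
    rintro (_ | _ | _ | _) h1 h2
    · exact absurd trivial h1
    · rfl
    · exact absurd trivial h2
    · rfl
  attack_nonempty := by
    rintro (_ | _ | _ | _) - h2
    any_goals exact absurd h2 id
    obtain ⟨γ, hγ, hh⟩ := G.exists_attack
    exact ⟨_, γ, hγ, fun _ => hh, rfl⟩
  closed := by
    rintro (⟨s, B, κ⟩ | ⟨s, B, a, γ, κ⟩ | ⟨s, B, γ, κ⟩ | _) hv m hm w hw
    · obtain ⟨a, γ, hγ, rfl⟩ := hm
      rw [G.mem_support_trans_p1 hε hw]
      exact ⟨hγ, G.post_singleton_subset hv a⟩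
    · obtain rfl : m = .chance := hm
      rcases G.mem_support_trans_nature hε hw with rfl | ⟨s', hs', rfl⟩
      · trivial
      · exact ⟨hv.1, hv.2 hs'⟩
    · obtain ⟨γ₂, hγ₂, -, rfl⟩ := hm
      rw [G.mem_support_trans_p2 hε hw]
      exact ⟨hv.2, G.mem_obs s γ hv.1 γ₂ hγ₂⟩
    · change w ∈ (G.trans ε hε .final m).support at hw
      rw [trans_final, PMF.support_pure] at hw
      rw [Set.mem_singleton_iff.1 hw]
      trivial
  mem_belief := id
  belief := fun _ ht => ht

theorem regular_delayAttackGame : (G.delayAttackGame ε hε τ).Regular where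
  final_mem := Or.inr rfl
  final_sink := G.trans_final hε .chance
  avail_chance := (G.regular_revealingGame hε).avail_chance
  attack_nonempty := by
    rintro v (hv | rfl) h2
    · exact (G.regular_revealingGame hε).attack_nonempty v hv.1 h2
    · exact absurd h2 id
  closed := by
    have hcl := (G.regular_revealingGame (τ := τ) hε).closed
    rintro v (hv | rfl) m hm w hw
    · have hw' := hcl v hv.1 m hm hw
      rcases v with ⟨s, B, κ⟩ | ⟨s, B, a, γ, κ⟩ | ⟨s, B, γ, κ⟩ | _
      · obtain ⟨a, γ, hγ, rfl⟩ := hm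
        obtain rfl := G.mem_support_trans_p1 hε hw
        exact Or.inl ⟨hw', G.nextCounter_nonneg hv.2⟩
      · obtain rfl : m = .chance := hm
        rcases G.mem_support_trans_nature hε hw with rfl | ⟨s', hs', rfl⟩
        · exact Or.inr rfl
        · exact Or.inl ⟨hw', hv.2⟩
      · obtain ⟨γ₂, hγ₂, -, rfl⟩ := hm
        obtain rfl := G.mem_support_trans_p2 hε hw
        exact Or.inl ⟨hw', hv.2⟩
      · exact absurd hv.2 id
    · change w ∈ (G.trans ε hε .final m).support at hw
      rw [trans_final, PMF.support_pure] at hw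
      exact Or.inr hw
  mem_belief := by
    rintro s B κ (h | h)
    · exact h.1
    · cases h
  belief := by
    rintro s t B κ (h | h) ht
    · exact Or.inl ⟨ht, h.2⟩
    · cases h

theorem queryNonempty_delayAttackGame : (G.delayAttackGame ε hε τ).QueryNonempty := by
  rintro (⟨s, B, κ⟩ | _ | _ | _) - h1
  · obtain ⟨a, γ, -, -, h⟩ := G.exists_mem_moves_p1 s B κ
    exact ⟨_, h⟩
  all_goals exact absurd h1 id

theorem avail_perceptualGame_subset (v : Vertex S A Sen τ) :
    (G.perceptualGame ε hε τ).avail v ⊆ G.moves v := by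
  rcases v with ⟨s, B, κ⟩ | ⟨s, B, a, γ, κ⟩ | ⟨s, B, γ, κ⟩ | _
  · rintro m ⟨a, γ, hγ, -, rfl⟩
    exact ⟨a, γ, hγ, rfl⟩
  · exact subset_rfl
  · rintro m ⟨γ₂, hγ₂, hh, rfl⟩
    exact ⟨γ₂, hγ₂, fun _ => hh, rfl⟩
  · exact subset_rfl

theorem regular_perceptualGame : (G.perceptualGame ε hε τ).Regular where
  final_mem := ⟨trivial, trivial⟩
  final_sink := G.trans_final hε .chance
  avail_chance := by
    rintro (_ | _ | _ | _) h1 h2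
    · exact absurd trivial h1
    · rfl
    · exact absurd trivial h2
    · rfl
  attack_nonempty := by
    rintro (_ | _ | _ | _) - h2
    any_goals exact absurd h2 id
    obtain ⟨γ, hγ, hh⟩ := G.exists_attack
    exact ⟨_, γ, hγ, hh, rfl⟩
  closed := by
    have hcl := (G.regular_revealingGame (τ := τ) hε).closed
    rintro v hv m hm w hw
    have hw' := hcl v hv.1 m (G.avail_perceptualGame_subset hε v hm) hw
    rcases v with ⟨s, B, κ⟩ | ⟨s, B, a, γ, κ⟩ | ⟨s, B, γ, κ⟩ | _
    · obtain ⟨a, γ, hγ, hh, rfl⟩ := hm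
      obtain rfl := G.mem_support_trans_p1 hε hw
      refine ⟨hw', ?_, hh⟩
      rw [G.nextCounter_of_notMem hv.2 hh]
      exact hv.2
    · obtain rfl : m = .chance := hm
      rcases G.mem_support_trans_nature hε hw with rfl | ⟨s', hs', rfl⟩
      · exact ⟨trivial, trivial⟩
      · exact ⟨hw', hv.2.1⟩
    · obtain ⟨γ₂, hγ₂, -, rfl⟩ := hm
      obtain rfl := G.mem_support_trans_p2 hε hw
      exact ⟨hw', hv.2⟩
    · change w ∈ (G.trans ε hε .final m).support at hw
      rw [trans_final, PMF.support_pure] at hw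
      rw [Set.mem_singleton_iff.1 hw]
      exact ⟨trivial, trivial⟩
  mem_belief := fun h => h.1
  belief := fun h ht => ⟨ht, h.2⟩

theorem queryNonempty_perceptualGame : (G.perceptualGame ε hε τ).QueryNonempty := by
  rintro (⟨s, B, κ⟩ | _ | _ | _) - h1
  · obtain ⟨a, γ, hγ, hh, -⟩ := G.exists_mem_moves_p1 s B κ
    exact ⟨_, a, γ, hγ, hh, rfl⟩
  all_goals exact absurd h1 id

/-! ### The initial game -/

section

variable {v : Vertex S A Sen τ}

theorem avail_initialGame_subset : (G.initialGame ε hε τ).avail v ⊆ G.moves v := by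
  by_cases hv : v ∈ (G.perceptualGame ε hε τ).ASW1 ∪ (G.perceptualGame ε hε τ).ASW2
  · simp only [initialGame, if_pos hv]
    exact subset_rfl
  · simp only [initialGame, if_neg hv]
    rcases v with ⟨s, B, κ⟩ | ⟨s, B, a, γ, κ⟩ | ⟨s, B, γ, κ⟩ | _
    · rintro m (hm | ⟨a, γ, hγ, -, rfl⟩)
      · exact G.avail_perceptualGame_subset hε _ (SR1_subset_avail _ hm)
      · exact ⟨a, γ, hγ, rfl⟩
    · exact subset_rfl
    · exact (SR2_subset_avail _).trans (G.avail_perceptualGame_subset hε _)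
    · exact subset_rfl

/-- Separates the artificial transitions from those of the revealing game. Redirection to the final
state happens only where P1 wins `G²` or `G⁺`, so an actual certificate is available there. -/
theorem δ_initialGame_cases (v : Vertex S A Sen τ) :
    ((∀ m, (G.initialGame ε hε τ).δ v m = PMF.pure .final) ∧
      (v ∈ (G.perceptualGame ε hε τ).ASW1 ∨ v ∈ (G.delayAttackGame ε hε τ).ASW1)) ∨
    (∀ m, (G.initialGame ε hε τ).δ v m = PMF.pure v) ∨
    ((∀ m, (G.initialGame ε hε τ).δ v m = G.trans ε hε v m) ∧
      v ∉ (G.perceptualGame ε hε τ).ASW1 ∪ (G.perceptualGame ε hε τ).ASW2 ∧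
      ∀ s B a γ κ, v = .nature s B a γ κ → (κ : ℤ) ≠ 0) := by
  by_cases h1 : v ∈ (G.perceptualGame ε hε τ).ASW1
  · left
    exact ⟨fun m => by simp only [initialGame, if_pos h1], Or.inl h1⟩
  by_cases h2 : v ∈ (G.perceptualGame ε hε τ).ASW2
  · right; left
    intro m
    simp only [initialGame, if_neg h1, if_pos h2]
  have h12 : v ∉ (G.perceptualGame ε hε τ).ASW1 ∪ (G.perceptualGame ε hε τ).ASW2 :=
    fun h => h.elim h1 h2
  simp only [initialGame, if_neg h1, if_neg h2]
  rcases v with ⟨s, B, κ⟩ | ⟨s, B, a, γ, κ⟩ | ⟨s, B, γ, κ⟩ | _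
  · exact Or.inr (Or.inr ⟨fun _ => rfl, h12, fun _ _ _ _ _ h => by cases h⟩)
  · by_cases hκ : (κ : ℤ) = 0
    · by_cases hp : (.nature s B a γ κ : Vertex S A Sen τ) ∈ (G.delayAttackGame ε hε τ).ASW1
      · left
        exact ⟨fun m => by simp only [if_pos hκ, if_pos hp], Or.inr hp⟩
      · right; left
        intro m
        simp only [if_pos hκ, if_neg hp]
    · right; right
      exact ⟨fun m => by simp only [if_neg hκ], h12, fun _ _ _ _ _ h => by cases h; exact hκ⟩
  · exact Or.inr (Or.inr ⟨fun _ => rfl, h12, fun _ _ _ _ _ h => by cases h⟩)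
  · exact Or.inr (Or.inr ⟨fun _ => rfl, h12, fun _ _ _ _ _ h => by cases h⟩)

/-- P2 always has a move because rationality in `G²` never excludes all of them (`SR2_nonempty`).
Nature states with counter `0` are absorbed at once, so no P2 position with counter `0` is needed.
-/
theorem regular_initialGame [Finite S] [Finite A] [Finite Sen] :
    (G.initialGame ε hε τ).Regular where
  final_mem := ⟨trivial, trivial⟩
  final_sink := by
    rcases G.δ_initialGame_cases hε (.final : Vertex S A Sen τ) with h | h | h
    · exact h.1 _
    · exact h _
    · rw [h.1, trans_final]
  avail_chance := by
    intro v h1 h2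
    have hmv := (G.regular_revealingGame hε).avail_chance v h1 h2
    by_cases hv : v ∈ (G.perceptualGame ε hε τ).ASW1 ∪ (G.perceptualGame ε hε τ).ASW2
    · simp only [initialGame, if_pos hv]
      exact hmv
    · simp only [initialGame, if_neg hv]
      rcases v with _ | _ | _ | _
      · exact absurd trivial h1
      · rfl
      · exact absurd trivial h2
      · rfl
  attack_nonempty := by
    rintro (_ | _ | ⟨s, B, γ, κ⟩ | _) hv h2
    any_goals exact absurd h2 id
    by_cases hr : .p2 s B γ κ ∈ (G.perceptualGame ε hε τ).ASW1 ∪ (G.perceptualGame ε hε τ).ASW2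
    · simp only [initialGame, if_pos hr]
      exact (G.regular_revealingGame hε).attack_nonempty _ hv.1 h2
    · simp only [initialGame, if_neg hr]
      exact SR2_nonempty (G.regular_perceptualGame hε) (G.queryNonempty_perceptualGame hε)
        ⟨hv.1, hv.2⟩ h2
  closed := by
    have hcl := (G.regular_revealingGame (τ := τ) hε).closed
    intro v hv m hm w hw
    rcases G.δ_initialGame_cases hε v with ⟨h, -⟩ | h | ⟨h, -, hnat⟩
    · rw [Arena.post, h, PMF.support_pure] at hw
      rw [Set.mem_singleton_iff.1 hw]
      exact ⟨trivial, trivial⟩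
    · rw [Arena.post, h, PMF.support_pure] at hw
      rw [Set.mem_singleton_iff.1 hw]
      exact hv
    rw [Arena.post, h] at hw
    have hm' := G.avail_initialGame_subset hε hm
    have hw' := hcl v hv.1 m hm' hw
    rcases v with ⟨s, B, κ⟩ | ⟨s, B, a, γ, κ⟩ | ⟨s, B, γ, κ⟩ | _
    · obtain ⟨a, γ, hγ, rfl⟩ := hm'
      obtain rfl := G.mem_support_trans_p1 hε hw
      refine ⟨hw', ?_⟩
      by_cases hh : G.hidden ∈ γ
      · exact Or.inr (G.nextCounter_of_mem hv.2 hh)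
      · left
        rw [G.nextCounter_of_notMem hv.2 hh]
        exact hv.2
    · obtain rfl : m = .chance := hm'
      rcases G.mem_support_trans_nature hε hw with rfl | ⟨s', hs', rfl⟩
      · exact ⟨trivial, trivial⟩
      · refine ⟨hw', hv.2.resolve_right (hnat _ _ _ _ _ rfl)⟩
    · obtain ⟨γ₂, hγ₂, -, rfl⟩ := hm'
      obtain rfl := G.mem_support_trans_p2 hε hw
      exact ⟨hw', hv.2⟩
    · rw [trans_final, PMF.support_pure] at hw
      rw [Set.mem_singleton_iff.1 hw]
      exact ⟨trivial, trivial⟩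
  mem_belief := fun h => h.1
  belief := fun h ht => ⟨ht, h.2⟩

end

/-! ### Deceptive winning -/

/-- The moves of P2 that its behaviorally subjectively rationalizable strategies can use. -/
def rationalMoves (ε : ℝ≥0) (hε : ε ≤ 1) (τ : ℕ) (v : Vertex S A Sen τ) : Set (Move A Sen) :=
  match v with
  | .p2 s B γ κ =>
      if (κ : ℤ) = -1 then (G.perceptualGame ε hε τ).SR2 (.p2 s B γ κ)
      else (G.delayAttackGame ε hε τ).SR2 (.p2 s B γ κ)
  | _ => ∅

theorem rationalMoves_perceptualGame {v : Vertex S A Sen τ}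
    (hv : v ∈ (G.perceptualGame ε hε τ).verts) (h2 : v.IsP2) :
    G.rationalMoves ε hε τ v = (G.perceptualGame ε hε τ).SR2 v := by
  rcases v with _ | _ | ⟨s, B, γ, κ⟩ | _
  any_goals exact absurd h2 id
  exact if_pos hv.2

theorem rationalMoves_delayAttackGame {v : Vertex S A Sen τ}
    (hv : v ∈ (G.delayAttackGame ε hε τ).verts) (h2 : v.IsP2) :
    G.rationalMoves ε hε τ v = (G.delayAttackGame ε hε τ).SR2 v := by
  rcases v with _ | _ | ⟨s, B, γ, κ⟩ | _
  any_goals exact absurd h2 id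
  rcases hv with hv | hv
  · have : 0 ≤ (κ : ℤ) := hv.2
    exact if_neg (by omega)
  · cases hv

theorem mem_verts_of_isP2 {v : Vertex S A Sen τ} (hv : v ∈ (G.revealingGame ε hε τ).verts)
    (h2 : v.IsP2) :
    v ∈ (G.perceptualGame ε hε τ).verts ∨ v ∈ (G.delayAttackGame ε hε τ).verts := by
  rcases v with _ | _ | ⟨s, B, γ, κ⟩ | _
  any_goals exact absurd h2 id
  by_cases hκ : (κ : ℤ) = -1
  · exact Or.inl ⟨hv, hκ⟩
  · exact Or.inr (Or.inl ⟨hv, counter_nonneg hκ⟩)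

theorem rationalMoves_nonempty [Finite S] [Finite A] [Finite Sen] {v : Vertex S A Sen τ}
    (hv : v ∈ (G.revealingGame ε hε τ).verts) (h2 : v.IsP2) :
    (G.rationalMoves ε hε τ v).Nonempty := by
  rcases G.mem_verts_of_isP2 hε hv h2 with h | h
  · rw [G.rationalMoves_perceptualGame hε h h2]
    exact SR2_nonempty (G.regular_perceptualGame hε) (G.queryNonempty_perceptualGame hε) h h2
  · rw [G.rationalMoves_delayAttackGame hε h h2]
    exact SR2_nonempty (G.regular_delayAttackGame hε) (G.queryNonempty_delayAttackGame hε) h h2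

theorem rationalMoves_subset {v : Vertex S A Sen τ}
    (hv : v ∈ (G.revealingGame ε hε τ).verts) (h2 : v.IsP2) :
    G.rationalMoves ε hε τ v ⊆ G.moves v := by
  rcases G.mem_verts_of_isP2 hε hv h2 with h | h
  · rw [G.rationalMoves_perceptualGame hε h h2]
    exact (SR2_subset_avail v).trans (G.avail_perceptualGame_subset hε v)
  · rw [G.rationalMoves_delayAttackGame hε h h2]
    exact SR2_subset_avail v

theorem support_subset_rationalMoves {π : Strategy S A Sen τ}
    (hπ : π ∈ G.rationalStrategies ε hε τ) (h : History S A Sen τ) {v : Vertex S A Sen τ}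
    (hv : v ∈ (G.revealingGame ε hε τ).verts) (h2 : v.IsP2) :
    (π h v).support ⊆ G.rationalMoves ε hε τ v := by
  obtain ⟨p, hp, hsupp⟩ := hπ
  rcases v with _ | _ | ⟨s, B, γ, κ⟩ | _
  any_goals exact absurd h2 id
  rw [hp]
  exact hsupp s B γ κ hv

theorem verts_perceptualGame_subset :
    (G.perceptualGame ε hε τ).verts ⊆ (G.revealingGame ε hε τ).verts :=
  fun _ hv => hv.1

theorem verts_delayAttackGame_subset :
    (G.delayAttackGame ε hε τ).verts ⊆ (G.revealingGame ε hε τ).verts :=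
  Set.union_subset (fun _ hv => hv.1) (by rintro _ rfl; exact trivial)

/-- Three certificates are glued in the revealing game, with those of `G⁺` and `G²` taking
precedence over that of `G⁰`. -/
theorem ASW1_subset_DASW1 [Finite S] [Finite A] [Finite Sen] :
    (G.initialGame ε hε τ).ASW1 ∪ (G.delayAttackGame ε hε τ).ASW1 ⊆ G.DASW1 ε hε τ := by
  have hH := G.regular_revealingGame (τ := τ) hε
  have hG0 := G.regular_initialGame (τ := τ) hε
  obtain ⟨fp, rp, hp, hpu⟩ := exists_certificate_ASW1 (G.regular_delayAttackGame (τ := τ) hε)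
  obtain ⟨f2, r2, h2, h2u⟩ := exists_certificate_ASW1 (G.regular_perceptualGame (τ := τ) hε)
  obtain ⟨f0, r0, h0, h0u⟩ := exists_certificate_ASW1 hG0
  have hpH := hp.transfer (G' := G.revealingGame ε hε τ) (R' := G.rationalMoves ε hε τ) rfl
    (hp.subset.trans (G.verts_delayAttackGame_subset hε)) (fun _ _ _ => subset_rfl)
    fun v hv hv2 => by
      rw [G.rationalMoves_delayAttackGame hε (hp.subset hv) hv2]
      exact SR2_subset_avail v
  have h2H := h2.transfer (G' := G.revealingGame ε hε τ) (R' := G.rationalMoves ε hε τ) rfl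
    (h2.subset.trans (G.verts_perceptualGame_subset hε))
    (fun v _ _ => G.avail_perceptualGame_subset hε v)
    fun v hv hv2 => by
      rw [G.rationalMoves_perceptualGame hε (h2.subset hv) hv2]
      exact SR2_subset_avail v
  obtain ⟨r, hC⟩ := hpH.union h2H
  have hCu := hpu.union h2u fun h => hH.mem_belief (h2H.subset h)
  -- Outside the two regions the winning positions of `G⁰` are neither redirected nor sinks, so
  -- there `G⁰` agrees with the revealing game played against rational moves.
  have key : ∀ v ∈ (G.initialGame ε hε τ).ASW1,
      v ∉ (G.delayAttackGame ε hε τ).ASW1 ∪ (G.perceptualGame ε hε τ).ASW1 →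
      (∀ m, (G.revealingGame ε hε τ).post v m = (G.initialGame ε hε τ).post v m) ∧
        (v.IsP2 → G.rationalMoves ε hε τ v = (G.initialGame ε hε τ).avail v) := by
    intro v hv hvC
    rcases G.δ_initialGame_cases hε v with ⟨-, h⟩ | h | ⟨h, hv12, -⟩
    · exact absurd h.symm hvC
    · exact absurd h (h0.not_sink hG0 hv fun hf => hvC (hf ▸ hC.final_mem))
    · refine ⟨fun m => ?_, fun hv2 => ?_⟩
      · simp only [Arena.post, h]
        rfl
      · have hverts := h0.subset hv
        rcases v with _ | _ | ⟨s, B, γ, κ⟩ | _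
        any_goals exact absurd hv2 id
        rw [G.rationalMoves_perceptualGame hε ⟨hverts.1, hverts.2⟩ hv2]
        simp only [initialGame, if_neg hv12]
  obtain ⟨r', hC'⟩ := hC.extend (W₂ := (G.initialGame ε hε τ).ASW1) (f₂ := f0) (r₂ := r0)
    (fun v hv => (h0.subset hv).1)
    (fun v hv _ hv2 => (h0.avail v hv hv2).trans (G.avail_initialGame_subset hε))
    (fun v hv hvC hv2 m hm => by
      rw [(key v hv hvC).1]
      exact (h0.closed₁ v hv hv2 m hm).trans Set.subset_union_right)
    (fun v hv hvC hv2 => by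
      obtain ⟨m, hm, w, hw, hwr⟩ := h0.decr₁ v hv hv2 fun hf => hvC (hf ▸ hC.final_mem)
      exact ⟨m, hm, w, (key v hv hvC).1 m ▸ hw, Or.inr hwr⟩)
    (fun v hv hvC hv2 m hm => by
      rw [(key v hv hvC).1]
      exact (h0.closed₂ v hv hv2 m ((key v hv hvC).2 hv2 ▸ hm)).trans Set.subset_union_right)
    (fun v hv hvC hv2 m hm => by
      obtain ⟨w, hw, hwr⟩ := h0.decr₂ v hv hv2 m ((key v hv hvC).2 hv2 ▸ hm)
      exact ⟨w, (key v hv hvC).1 m ▸ hw, Or.inr hwr⟩)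
  have hsub := hC'.subset_winRegion (Opp := G.rationalStrategies ε hε τ) hH
    (hCu.union h0u fun h => hG0.mem_belief (h0.subset h))
    fun π hπ h v hv hv2 => G.support_subset_rationalMoves hε hπ h hv hv2
  rintro q (hq | hq)
  · exact hsub (Or.inr hq)
  · exact hsub (Or.inl (Or.inl hq))

/-- Once the hidden sensor is revealed, rational moves are those of `SR2` in `G⁺`, and winning
against them is winning against all moves by `Certificate.of_SR2`. -/
theorem DASW1_inter_subset [Finite S] [Finite A] [Finite Sen] :
    G.DASW1 ε hε τ ∩ (G.delayAttackGame ε hε τ).verts ⊆ (G.delayAttackGame ε hε τ).ASW1 := by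
  rintro q ⟨hq, hqp⟩
  have hGp := G.regular_delayAttackGame (τ := τ) hε
  obtain ⟨f, W, r, hqW, hC, hf⟩ := exists_certificate_of_mem_winRegion
    (R := G.rationalMoves ε hε τ) (G.regular_revealingGame hε)
    (fun v hv h2 => G.rationalMoves_nonempty hε hv h2)
    (fun v hv h2 => G.rationalMoves_subset hε hv h2)
    (fun π hπ h v hv h2 => G.support_subset_rationalMoves hε hπ h hv h2)
    -- The rational strategies are rich enough: they include every memoryless choice among the
    -- rational moves.
    (fun p hp => ⟨p, fun _ _ => rfl, fun s B γ κ hv => hp _ hv trivial⟩) hq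
  have hCp := hC.restrict (R' := (G.delayAttackGame ε hε τ).SR2) hGp rfl
    (fun _ _ _ => subset_rfl)
    (fun v hv h2 => (G.rationalMoves_delayAttackGame hε hv h2).ge)
    (fun v _ _ => SR2_subset_avail v)
  have hCa := hCp.of_SR2 hGp (G.queryNonempty_delayAttackGame hε)
  refine hCa.subset_winRegion (Opp := (G.delayAttackGame ε hε τ).strategies2) hGp ?_
    (fun π hπ h v hv h2 => hπ h v hv h2) ⟨hqW, hqp⟩
  intro s t B κ hs ht
  obtain ⟨ht', heq⟩ := hf s t B κ hs.1 ht
  exact ⟨⟨ht', hGp.belief hs.2 ht⟩, heq⟩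

end SensorGame

end SensorDeception

/-! ### The lemma on deceptive winning regions. -/

theorem mainTheorem5 {S A Sen : Type*} [Finite S] [Finite A] [Finite Sen]
    (G : SensorDeception.SensorGame S A Sen) (τ : ℕ) (ε : NNReal) (_hε₀ : 0 < ε) (hε₁ : ε < 1) :
    (G.initialGame ε hε₁.le τ).ASW1 ∪ (G.delayAttackGame ε hε₁.le τ).ASW1 ⊆
        G.DASW1 ε hε₁.le τ ∧
      G.DASW1 ε hε₁.le τ ∩ G.revealedStates τ =
        (G.delayAttackGame ε hε₁.le τ).ASW1 ∩ G.revealedStates τ := by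
  have hsub := G.ASW1_subset_DASW1 (τ := τ) hε₁.le
  refine ⟨hsub, subset_antisymm ?_ ?_⟩
  · rintro q ⟨hq, hqr⟩
    exact ⟨G.DASW1_inter_subset hε₁.le ⟨hq, Or.inl hqr⟩, hqr⟩
  · rintro q ⟨hq, hqr⟩
    exact ⟨hsub (Or.inr hq), hqr⟩
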